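/- Let $k$ be a field of characteristic zero and let $X$ be a normal integral scheme locally of finite type over $k$, with generic point $\eta$. Let $\mathscr{F}$ be a foliation on $X$ over $k$, that is, a quasi-coherent quotient $\Omega^1_{X/k}\to\mathscr{F}$ such that, over some dense open subset of $X$, the exterior derivative of $\bigoplus_{n>0}\Omega^n_{X/k}$ descends to $\bigoplus_{n>0}\Lambda^n\mathscr{F}$. Let $d_{\mathscr{F}}:\mathscr{O}_X\to\Omega^1_{X/k}\to\mathscr{F}$ be the induced derivation, let $\mathscr{O}_X^{\mathscr{F}}=\ker(d_{\mathscr{F}})\subseteq\mathscr{O}_X$ be the sheaf of first integrals, let $\mathscr{O}_{X,\eta}^{\mathscr{F}}=\ker(d_{\mathscr{F},\eta}:\mathscr{O}_{X,\eta}\to\mathscr{F}_\eta)$, and let $\mathrm{rank}\,\mathscr{F}=\dim_{\mathscr{O}_{X,\eta}}\mathscr{F}_\eta$. Suppose that 1. $\mathscr{F}$ is algebraically integrable: $\mathrm{rank}\,\mathscr{F}=\mathrm{tr\,deg}_{\mathscr{O}_{X,\eta}^{\mathscr{F}}}\mathscr{O}_{X,\eta}$; 2. $\mathscr{F}$ is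 torsion-free; 3. the first integrals of $\mathscr{F}$ are locally of finite type over $k$: for every affine open $U\subseteq X$, $\Gamma(U,\mathscr{O}_X^{\mathscr{F}})$ is a $k$-algebra of finite type. Then $\eta$ is $\mathscr{F}$-stable: there is an affine open subset $U\subseteq X$ containing $\eta$ such that the morphism $\mathrm{Spec}\,\Gamma(U,\mathscr{O}_X)\to\mathrm{Spec}\,\Gamma(U,\mathscr{O}_X^{\mathscr{F}})$ induced by the inclusion is smooth, of relative dimension $\mathrm{rank}\,\mathscr{F}$, and has geometrically connected fibres. -/

import Mathlib

open CategoryTheory AlgebraicGeometry TopologicalSpace Opposite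

universe u

noncomputable section

namespace Foliated

variable {k : Type u} [Field k] {X : Scheme.{u}}

/-- The constants `k ⟶ Γ(X, U)` for a scheme `f : X ⟶ Spec k`, as a morphism from the constant
presheaf of rings `k` to the structure sheaf of `X`. -/
def constants (f : X ⟶ Spec (CommRingCat.of k)) :
    (Functor.const (Opens X)ᵒᵖ).obj (CommRingCat.of k) ⟶ X.presheaf where
  app U := (Scheme.ΓSpecIso (CommRingCat.of k)).inv ≫ f.appTop ≫
    X.presheaf.map (homOfLE (le_top : U.unop ≤ ⊤)).op
  naturality U V i := by
    simp only [Functor.const_obj_obj, Functor.const_obj_map, Category.id_comp, Category.assoc,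
      ← Functor.map_comp]
    rfl

/-- The presheaf `U ↦ Ω¹_{Γ(X, U) / k}` of `𝒪_X`-modules. -/
def preCotangent (f : X ⟶ Spec (CommRingCat.of k)) : X.PresheafOfModules :=
  PresheafOfModules.DifferentialsConstruction.relativeDifferentials' (constants f)

/-- The cotangent sheaf `Ω¹_{X/k}`: the sheafification of `U ↦ Ω¹_{Γ(X, U) / k}`. -/
def cotangent (f : X ⟶ Spec (CommRingCat.of k)) : X.Modules :=
  (PresheafOfModules.sheafification (𝟙 X.ringCatSheaf.obj)).obj (preCotangent f)

/-- The sheafification map `Ω¹_{Γ(X, U) / k} ⟶ Γ(U, Ω¹_{X/k})`. -/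
def toCotangent (f : X ⟶ Spec (CommRingCat.of k)) :
    preCotangent f ⟶ (Scheme.Modules.toPresheafOfModules X).obj (cotangent f) :=
  (PresheafOfModules.sheafificationAdjunction (𝟙 X.ringCatSheaf.obj)).unit.app (preCotangent f)

/-- A distribution on `X` over `k`: a quasi-coherent quotient of `Ω¹_{X/k}`. -/
structure Distribution (f : X ⟶ Spec (CommRingCat.of k)) where
  /-- the sheaf of modules `ℱ` -/
  sheaf : X.Modules
  /-- the quotient map `Ω¹_{X/k} ⟶ ℱ` -/
  quot : cotangent f ⟶ sheaf
  quasicoherent : sheaf.IsQuasicoherent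
  epi : Epi quot

namespace Distribution

variable {f : X ⟶ Spec (CommRingCat.of k)} (F : Distribution f)

/-- The derivation `d_ℱ : 𝒪_X ⟶ Ω¹_{X/k} ⟶ ℱ` relative to `k`. -/
def derivation :
    PresheafOfModules.Derivation' (R := X.presheaf)
      ((Scheme.Modules.toPresheafOfModules X).obj F.sheaf) (constants f) :=
  (PresheafOfModules.DifferentialsConstruction.derivation' (constants f)).postcomp
    (toCotangent f ≫ (Scheme.Modules.toPresheafOfModules X).map F.quot)

/-- The map `d_ℱ : Γ(U, 𝒪_X) → Γ(U, ℱ)`. -/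
def d (U : X.Opens) : Γ(X, U) →+ Γ(F.sheaf, U) :=
  F.derivation.d (X := op U)

lemma d_mul (U : X.Opens) (a b : Γ(X, U)) : F.d U (a * b) = a • F.d U b + b • F.d U a :=
  F.derivation.d_mul (X := op U) a b

lemma d_map {U V : X.Opens} (i : op U ⟶ op V) (a : Γ(X, U)) :
    F.d V (X.presheaf.map i a) = F.sheaf.presheaf.map i (F.d U a) :=
  F.derivation.d_map i a

lemma d_constants (U : X.Opens) (c : k) : F.d U ((constants f).app (op U) c) = 0 :=
  F.derivation.d_app (X := op U) c

lemma d_one (U : X.Opens) : F.d U 1 = 0 := by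
  simpa using F.d_mul U 1 1

/-- The ring of first integrals `Γ(U, 𝒪_X^ℱ)`, the kernel of `d_ℱ` on `Γ(U, 𝒪_X)`. -/
def firstIntegrals (U : X.Opens) : Subring Γ(X, U) where
  carrier := {a | F.d U a = 0}
  mul_mem' {a b} ha hb := by
    simp only [Set.mem_ofPred_eq] at ha hb ⊢
    rw [F.d_mul, ha, hb, smul_zero, smul_zero, add_zero]
  one_mem' := F.d_one U
  add_mem' {a b} ha hb := by
    simp only [Set.mem_ofPred_eq] at ha hb ⊢
    rw [map_add, ha, hb, add_zero]
  zero_mem' := map_zero _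
  neg_mem' {a} ha := by
    simp only [Set.mem_ofPred_eq] at ha ⊢
    rw [map_neg, ha, neg_zero]

/-- The structure map `k → Γ(U, 𝒪_X^ℱ)`. -/
def constToFirstIntegrals (U : X.Opens) : k →+* F.firstIntegrals U :=
  ((constants f).app (op U)).hom.codRestrict (F.firstIntegrals U) (F.d_constants U)

/-- The first integrals are locally of finite type over `k`: `Γ(U, 𝒪_X^ℱ)` is a `k`-algebra of
finite type for every affine open `U`. -/
def FirstIntegralsLocallyOfFiniteType : Prop :=
  ∀ U : X.Opens, IsAffineOpen U → (F.constToFirstIntegrals U).FiniteType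

/-- `d_ℱ` as a morphism of presheaves of abelian groups. -/
def dPresheaf : X.presheaf ⋙ forget₂ CommRingCat RingCat ⋙ forget₂ RingCat AddCommGrpCat ⟶
    F.sheaf.presheaf where
  app U := AddCommGrpCat.ofHom (F.d U.unop)
  naturality U V i := by
    ext a
    exact F.d_map i a

/-- The map `d_{ℱ, x} : 𝒪_{X, x} → ℱ_x` induced by `d_ℱ` on stalks. -/
def dStalk (x : X) : X.presheaf.stalk x →+ F.sheaf.presheaf.stalk x :=
  ((Limits.isColimitOfPreserves
      (forget₂ CommRingCat RingCat ⋙ forget₂ RingCat AddCommGrpCat)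
      (Limits.colimit.isColimit ((OpenNhds.inclusion x).op ⋙ X.presheaf))).map
    (Limits.colimit.cocone ((OpenNhds.inclusion x).op ⋙ F.sheaf.presheaf))
    (Functor.whiskerLeft (OpenNhds.inclusion x).op F.dPresheaf)).hom

lemma dStalk_germ (x : X) (U : X.Opens) (hx : x ∈ U) (a : Γ(X, U)) :
    F.dStalk x (X.presheaf.germ U x hx a) =
      TopCat.Presheaf.germ F.sheaf.presheaf U x hx (F.d U a) := by
  have h := (Limits.isColimitOfPreserves
      (forget₂ CommRingCat RingCat ⋙ forget₂ RingCat AddCommGrpCat)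
      (Limits.colimit.isColimit ((OpenNhds.inclusion x).op ⋙ X.presheaf))).fac
    ((Limits.Cocone.precompose
      (Functor.whiskerLeft (OpenNhds.inclusion x).op F.dPresheaf)).obj
    (Limits.colimit.cocone ((OpenNhds.inclusion x).op ⋙ F.sheaf.presheaf)))
    (op ⟨U, hx⟩)
  exact congrArg (fun g => g.hom a) h

/-- The `𝒪_{X, x}`-module structure on the stalk `ℱ_x`. -/
instance stalkModule (x : X) : Module (X.presheaf.stalk x) (F.sheaf.presheaf.stalk x) :=
  PresheafOfModules.instModuleCarrierStalkCommRingCatCarrierAbPresheafOpensCarrier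
    (R := X.presheaf) F.sheaf.val x

lemma germ_smul (x : X) (U : X.Opens) (hx : x ∈ U) (a : Γ(X, U)) (m : Γ(F.sheaf, U)) :
    TopCat.Presheaf.germ F.sheaf.presheaf U x hx (a • m) =
      X.presheaf.germ U x hx a • TopCat.Presheaf.germ F.sheaf.presheaf U x hx m :=
  PresheafOfModules.germ_smul (R := X.presheaf) F.sheaf.val x U hx a m

lemma dStalk_mul (x : X) (s t : X.presheaf.stalk x) :
    F.dStalk x (s * t) = s • F.dStalk x t + t • F.dStalk x s := by
  obtain ⟨U, hU, a, rfl⟩ := X.presheaf.exists_germ_eq s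
  obtain ⟨V, hV, b, rfl⟩ := X.presheaf.exists_germ_eq t
  have hW : x ∈ U ⊓ V := ⟨hU, hV⟩
  have ha := X.presheaf.germ_res_apply (homOfLE (inf_le_left : U ⊓ V ≤ U)) x hW a
  have hb := X.presheaf.germ_res_apply (homOfLE (inf_le_right : U ⊓ V ≤ V)) x hW b
  have key (a b : Γ(X, U ⊓ V)) :
      F.dStalk x (X.presheaf.germ _ x hW a * X.presheaf.germ _ x hW b) =
        X.presheaf.germ _ x hW a • F.dStalk x (X.presheaf.germ _ x hW b) +
          X.presheaf.germ _ x hW b • F.dStalk x (X.presheaf.germ _ x hW a) := by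
    rw [← map_mul, dStalk_germ, dStalk_germ, dStalk_germ, d_mul, map_add, germ_smul, germ_smul]
  rw [← ha, ← hb]
  exact key _ _

/-- The ring of local first integrals `𝒪_{X, x}^ℱ`, the kernel of `d_{ℱ, x}` on `𝒪_{X, x}`. -/
def localFirstIntegrals (x : X) : Subring (X.presheaf.stalk x) where
  carrier := {s | F.dStalk x s = 0}
  mul_mem' {s t} hs ht := by
    simp only [Set.mem_ofPred_eq] at hs ht ⊢
    rw [F.dStalk_mul, hs, ht, smul_zero, smul_zero, add_zero]
  one_mem' := by
    have h := F.dStalk_mul x 1 1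
    simpa using h
  add_mem' {s t} hs ht := by
    simp only [Set.mem_ofPred_eq] at hs ht ⊢
    rw [map_add, hs, ht, add_zero]
  zero_mem' := map_zero _
  neg_mem' {s} hs := by
    simp only [Set.mem_ofPred_eq] at hs ⊢
    rw [map_neg, hs, neg_zero]

/-- `ℱ` is involutive: over a dense open subset, the exterior derivative of `Ω^•_{X/k}` descends to
`Λ^•ℱ` in positive degrees. On an affine open `V`, the group `Ω^n` is additively generated by the
forms `b da₁ ∧ ⋯ ∧ daₙ`, the exterior derivative is the additive map sending such a form to
`db ∧ da₁ ∧ ⋯ ∧ daₙ`, and `Ω^n → Λ^nℱ` sends it to `b d_ℱ a₁ ∧ ⋯ ∧ d_ℱ aₙ`. So a descended map is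
an additive map `Λ^nℱ → Λ^{n+1}ℱ` with the formula below; it is unique, hence compatible with
restriction. -/
def IsInvolutive : Prop :=
  ∃ U : X.Opens, Dense (U : Set X) ∧ ∀ V : X.Opens, IsAffineOpen V → V ≤ U → ∀ n : ℕ, 0 < n →
    ∃ D : (⋀[Γ(X, V)]^n Γ(F.sheaf, V)) →+ (⋀[Γ(X, V)]^(n + 1) Γ(F.sheaf, V)),
      ∀ (b : Γ(X, V)) (a : Fin n → Γ(X, V)),
        D (b • exteriorPower.ιMulti Γ(X, V) n (fun i => F.d V (a i))) =
          exteriorPower.ιMulti Γ(X, V) (n + 1) (Fin.cons (F.d V b) (fun i => F.d V (a i)))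

/-- On an integral scheme: `Γ(U, ℱ)` is a torsion-free `Γ(U, 𝒪_X)`-module for every affine open
`U`. -/
def IsTorsionFree : Prop :=
  ∀ U : X.Opens, IsAffineOpen U → ∀ (a : Γ(X, U)) (m : Γ(F.sheaf, U)), a • m = 0 → a = 0 ∨ m = 0

section Integral

variable [IsIntegral X]

/-- The rank of `ℱ`: the dimension of the generic stalk `ℱ_η` over the field `𝒪_{X, η}`. -/
def rank : ℕ :=
  Module.finrank (X.presheaf.stalk (genericPoint X)) (F.sheaf.presheaf.stalk (genericPoint X))

/-- `ℱ` is algebraically integrable: its rank is the transcendence degree of `𝒪_{X, η}` over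
`𝒪_{X, η}^ℱ`. -/
def IsAlgebraicallyIntegrable : Prop :=
  (F.rank : Cardinal) =
    Algebra.trdeg (F.localFirstIntegrals (genericPoint X)) (X.presheaf.stalk (genericPoint X))

/-- The morphism `Spec Γ(U, 𝒪_X) ⟶ Spec Γ(U, 𝒪_X^ℱ)` induced by the inclusion. -/
def toSpecFirstIntegrals (U : X.Opens) :
    Spec Γ(X, U) ⟶ Spec (CommRingCat.of (F.firstIntegrals U)) :=
  Spec.map (CommRingCat.ofHom (F.firstIntegrals U).subtype)

/-- The point `x` is `ℱ`-stable: it has an affine open neighbourhood `U` such that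
`Γ(U, 𝒪_X^ℱ) → Γ(U, 𝒪_X)` is smooth, of relative dimension the rank of `ℱ`, with geometrically
connected fibres. -/
def IsStable (x : X) : Prop :=
  ∃ U : X.Opens, IsAffineOpen U ∧ x ∈ U ∧
    Smooth (F.toSpecFirstIntegrals U) ∧
    SmoothOfRelativeDimension F.rank (F.toSpecFirstIntegrals U) ∧
    GeometricallyConnected (F.toSpecFirstIntegrals U)

end Integral

end Distribution

end Foliated

end

/-!
# Stability of the generic point of an algebraically integrable foliation

Let `K` be the function field of `X` and `L ⊆ K` the field of first integrals at the generic point.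
In characteristic zero a derivation that kills `L` kills everything algebraic over `L`, so `L` is
relatively algebraically closed in `K`
(`Distribution.mem_firstIntegralField_of_isAlgebraic`): the extension `K / L` is regular, of
transcendence degree the rank `r` of the foliation.

*Spreading out.* Choose an affine open `V` on which a transcendence basis of `L` over `k` is defined
and killed by `d`, and put `A = Γ(V, 𝒪^ℱ)`, `B = Γ(V, 𝒪)`. An element of `L` becomes integral over
`A` after multiplication by an element of `A`, hence lies in `B` as `X` is normal, and is then
killed by `d` as `ℱ` is torsion-free; so `L` is the field of fractions of `A`
(`Distribution.exists_isFractionRing_firstIntegrals`).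

*Commutative algebra.* Let `B` be a domain of finite type over `A`, such that the extension `K / L`
of fields of fractions is as above. By the theorem of the primitive element, up to localization `B`
is `A[x₁, …, xᵣ, t] / (g)` with `g` monic in `t` and with invertible derivative
(`exists_hypersurfaceChart`), so it is étale over a polynomial ring in `r` variables. As `K / L` is
regular, `g` is irreducible over the algebraic closure of `L` (`prime_map_algebraicClosure`), and by
the theorem of Bertini and Noether it stays irreducible over every field to which `A[1/a]` maps, for
a suitable `a ≠ 0` (`exists_ne_zero_forall_irreducible_map`). So there are localizations
`A[1/a] → B[1/b]` that are smooth of relative dimension `r` and such that `κ ⊗ B[1/b]` is a domain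
for every field `κ` over `A[1/a]` (`exists_smooth_localization`).

*Conclusion.* Let `U ⊆ V` be the locus where `b` is invertible. As `A[1/a] → B[1/b]` is faithfully
flat, a fraction of elements of `A` that lies in `Γ(U, 𝒪) = B[1/b]` lies in `A[1/a]`. So
`Γ(U, 𝒪^ℱ) = A[1/a]` (`isLocalization_away_of_faithfullyFlat`), and the morphism in question is the
spectrum of `A[1/a] → B[1/b]`.
-/

namespace Foliated

/-! ### Irreducible polynomials under specialization -/

section Elimination

open MvPolynomial

attribute [local instance] MvPolynomial.algebraMvPolynomial

/-- Elimination: an ideal of `A[T]` without zeros in an algebraically closed field containing `A`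
contains a nonzero constant. This is the Nullstellensatz over the field of fractions `L`, with
denominators cleared. -/
lemma exists_C_mem_of_no_zero {A L Ω T : Type*} [CommRing A] [IsDomain A]
    [Field L] [Algebra A L] [IsFractionRing A L] [Field Ω] [IsAlgClosed Ω] [Algebra L Ω]
    [Algebra A Ω] [IsScalarTower A L Ω] [Finite T] (I : Ideal (MvPolynomial T A))
    (hI : ∀ z : T → Ω, ∃ p ∈ I, aeval z p ≠ 0) : ∃ a : A, a ≠ 0 ∧ C a ∈ I := by
  by_cases hJ : I.map (algebraMap (MvPolynomial T A) (MvPolynomial T L)) = ⊤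
  · have h := (IsLocalization.map_algebraMap_ne_top_iff_disjoint
      ((nonZeroDivisors A).map (C (σ := T))) (MvPolynomial T L) I).not.mp (not_not.mpr hJ)
    obtain ⟨_, ⟨a, ha, rfl⟩, haI⟩ := Set.not_disjoint_iff.mp h
    exact ⟨a, nonZeroDivisors.ne_zero ha, haI⟩
  · exfalso
    obtain ⟨m, hm, hIm⟩ := Ideal.exists_le_maximal _ hJ
    let : Field (MvPolynomial T L ⧸ m) := Ideal.Quotient.field m
    have : Module.Finite L (MvPolynomial T L ⧸ m) := finite_of_finite_type_of_isJacobsonRing _ _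
    let ψ : (MvPolynomial T L ⧸ m) →ₐ[L] Ω := IsAlgClosed.lift
    let χ : MvPolynomial T L →ₐ[L] Ω := ψ.comp (Ideal.Quotient.mkₐ L m)
    obtain ⟨p, hp, hne⟩ := hI fun i => χ (X i)
    apply hne
    have h1 : χ (algebraMap (MvPolynomial T A) (MvPolynomial T L) p) = 0 := by
      have : Ideal.Quotient.mkₐ L m (algebraMap (MvPolynomial T A) (MvPolynomial T L) p) = 0 :=
        Ideal.Quotient.eq_zero_iff_mem.mpr (hIm (Ideal.mem_map_of_mem _ hp))
      simp only [χ, AlgHom.comp_apply, this, map_zero]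
    rw [← h1, MvPolynomial.algebraMap_def]
    conv_rhs => rw [aeval_unique χ]
    rw [aeval_map_algebraMap]
    rfl

lemma exists_coeff_ne_zero_of_not_isUnit {σ κ : Type*} [Field κ] {p : MvPolynomial σ κ}
    (hp : p ≠ 0) (h : ¬ IsUnit p) : ∃ m, m ≠ 0 ∧ p.coeff m ≠ 0 := by
  classical
  by_contra! H
  have hC : p = C (p.coeff 0) := by
    ext m
    by_cases hm : m = 0
    · simp [hm]
    · rw [H m hm, coeff_C, if_neg (Ne.symm hm)]
  refine h ?_
  rw [hC] at hp ⊢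
  exact (IsUnit.mk0 _ (by simpa using hp)).map C

lemma not_isUnit_of_coeff_ne_zero {σ κ : Type*} [CommRing κ] [IsDomain κ] {p : MvPolynomial σ κ}
    {m : σ →₀ ℕ} (hm : m ≠ 0) (h : p.coeff m ≠ 0) : ¬ IsUnit p := by
  classical
  intro hu
  obtain ⟨q, hq⟩ := hu.exists_right_inv
  have hp0 : p ≠ 0 := by rintro rfl; simp at h
  have hq0 : q ≠ 0 := by rintro rfl; simp at hq
  have := totalDegree_mul_of_isDomain hp0 hq0
  rw [hq, totalDegree_one] at this
  have h0 : p.totalDegree = 0 := by omega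
  rw [totalDegree_eq_zero_iff_eq_C] at h0
  rw [h0, coeff_C, if_neg (Ne.symm hm)] at h
  exact h rfl

/-- Factorizations of `g` into two factors of degree at most `d`, with nonvanishing coefficients at
`m₁` and `m₂` respectively, are the zeros of an ideal over `A`. If there are none over `Ω`, then by
elimination there are none over any field to which `A[1/a]` maps, for some `a ≠ 0`. -/
lemma exists_ne_zero_forall_no_factorization {A L Ω σ : Type*} [CommRing A] [IsDomain A]
    [Field L] [Algebra A L] [IsFractionRing A L] [Field Ω] [IsAlgClosed Ω] [Algebra L Ω]
    [Algebra A Ω] [IsScalarTower A L Ω] [Finite σ] {g : MvPolynomial σ A}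
    (hg : Irreducible (map (algebraMap A Ω) g)) (d : ℕ) {m₁ m₂ : σ →₀ ℕ}
    (h₁ : m₁ ≠ 0) (h₂ : m₂ ≠ 0) :
    ∃ a : A, a ≠ 0 ∧ ∀ (κ : Type u) [Field κ] (φ : A →+* κ), φ a ≠ 0 →
      ∀ p q : MvPolynomial σ κ, p * q = map φ g → p.totalDegree ≤ d → q.totalDegree ≤ d →
        p.coeff m₁ ≠ 0 → q.coeff m₂ = 0 := by
  classical
  have hfin : {m : σ →₀ ℕ | m.degree ≤ d}.Finite := Finsupp.finite_of_degree_le d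
  let M := hfin.toFinset
  -- unknown coefficients of the two factors, and the inverse of a product of two of them
  let T := Option (M ⊕ M)
  let P : MvPolynomial σ (MvPolynomial T A) :=
    ∑ m : M, monomial m.1 (X (some (Sum.inl m)))
  let Q : MvPolynomial σ (MvPolynomial T A) :=
    ∑ m : M, monomial m.1 (X (some (Sum.inr m)))
  let R := P * Q - map C g
  let e : MvPolynomial T A := X none * (P.coeff m₁ * Q.coeff m₂) - 1
  let I : Ideal (MvPolynomial T A) := Ideal.span (insert e (Set.range fun m => R.coeff m))
  obtain ⟨a, ha, haI⟩ := exists_C_mem_of_no_zero (L := L) (Ω := Ω) I (by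
    intro z
    by_contra! H
    have he : aeval z e = 0 := H _ (Ideal.subset_span (Set.mem_insert _ _))
    have hR : map (aeval z : MvPolynomial T A →ₐ[A] Ω).toRingHom R = 0 := by
      ext m
      rw [coeff_map]
      exact H _ (Ideal.subset_span (Set.mem_insert_of_mem _ ⟨m, rfl⟩))
    simp only [R, map_sub, map_mul, sub_eq_zero, map_map] at hR
    have hc : (aeval z : MvPolynomial T A →ₐ[A] Ω).toRingHom.comp C = algebraMap A Ω := by
      ext; simp
    rw [hc] at hR
    have hne : aeval z (P.coeff m₁) ≠ 0 ∧ aeval z (Q.coeff m₂) ≠ 0 := by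
      constructor <;> intro h0 <;> simp [e, h0] at he
    rcases hg.isUnit_or_isUnit hR.symm with hu | hu
    · exact not_isUnit_of_coeff_ne_zero h₁ (by rw [coeff_map]; exact hne.1) hu
    · exact not_isUnit_of_coeff_ne_zero h₂ (by rw [coeff_map]; exact hne.2) hu)
  refine ⟨a, ha, fun κ _ φ hφ p q hpq hp hq hp1 => ?_⟩
  by_contra hq2
  apply hφ
  let z : T → κ := fun i => i.elim ((p.coeff m₁ * q.coeff m₂)⁻¹)
    (Sum.elim (fun m => p.coeff m.1) (fun m => q.coeff m.1))
  let θ : MvPolynomial T A →+* κ := eval₂Hom φ z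
  have key (f : MvPolynomial σ κ) (hf : f.totalDegree ≤ d) :
      ∑ m : M, monomial m.1 (f.coeff m.1) = f := by
    rw [Finset.sum_coe_sort M (fun m => monomial m (f.coeff m))]
    conv_rhs => rw [f.as_sum]
    symm
    apply Finset.sum_subset
    · intro m hm
      simp only [M, Set.Finite.mem_toFinset, Set.mem_ofPred_eq]
      refine le_trans ?_ hf
      exact le_totalDegree hm
    · intro m _ hm
      simp [notMem_support_iff.mp hm]
  have hP : map θ P = p := by
    simp only [P, map_sum, map_monomial]
    simpa [θ, z] using key p hp
  have hQ : map θ Q = q := by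
    simp only [Q, map_sum, map_monomial]
    simpa [θ, z] using key q hq
  have hR : map θ R = 0 := by
    have hc : θ.comp C = φ := by ext; simp [θ]
    simp only [R, map_sub, map_mul, map_map, hP, hQ, hc, hpq, sub_self]
  have hI : I ≤ RingHom.ker θ := by
    refine Ideal.span_le.mpr ?_
    rintro _ (rfl | ⟨m, rfl⟩)
    · have h1 : θ (P.coeff m₁) = p.coeff m₁ := by rw [← coeff_map, hP]
      have h2 : θ (Q.coeff m₂) = q.coeff m₂ := by rw [← coeff_map, hQ]
      have h3 : θ (X none) = (p.coeff m₁ * q.coeff m₂)⁻¹ := by simp [θ, z]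
      have h4 : p.coeff m₁ * q.coeff m₂ ≠ 0 := mul_ne_zero hp1 hq2
      simp only [SetLike.mem_coe, RingHom.mem_ker, e, map_sub, map_mul, h1, h2, h3, map_one]
      rw [inv_mul_cancel₀ h4, sub_self]
    · simp only [SetLike.mem_coe, RingHom.mem_ker]
      rw [← coeff_map, hR, coeff_zero]
  have := hI haI
  rw [RingHom.mem_ker] at this
  simpa [θ] using this

/-- The theorem of Bertini and Noether: a polynomial over a domain `A` that is irreducible over an
algebraically closed extension of the field of fractions stays irreducible over every field to which
`A[1/a]` maps, for some `a ≠ 0`. -/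
theorem exists_ne_zero_forall_irreducible_map {A L Ω σ : Type*} [CommRing A] [IsDomain A]
    [Field L] [Algebra A L] [IsFractionRing A L] [Field Ω] [IsAlgClosed Ω] [Algebra L Ω]
    [Algebra A Ω] [IsScalarTower A L Ω] [Finite σ] {g : MvPolynomial σ A}
    (hg : Irreducible (map (algebraMap A Ω) g)) :
    ∃ a : A, a ≠ 0 ∧ ∀ (κ : Type u) [Field κ] (φ : A →+* κ), φ a ≠ 0 →
      Irreducible (map φ g) := by
  classical
  set d := g.totalDegree
  have hfin : {m : σ →₀ ℕ | m.degree ≤ d}.Finite := Finsupp.finite_of_degree_le d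
  let M := hfin.toFinset.erase 0
  have H (m : M × M) := exists_ne_zero_forall_no_factorization.{u} (L := L) hg d
    (Finset.ne_of_mem_erase m.1.2) (Finset.ne_of_mem_erase m.2.2)
  choose a ha hA using H
  obtain ⟨m₀, hm₀, hc₀⟩ := exists_coeff_ne_zero_of_not_isUnit hg.ne_zero hg.not_isUnit
  rw [coeff_map] at hc₀
  -- the coefficient at `m₀` keeps `g` from becoming a unit or zero
  refine ⟨g.coeff m₀ * ∏ m, a m, mul_ne_zero (fun h => hc₀ (by rw [h, map_zero]))
    (Finset.prod_ne_zero_iff.mpr fun m _ => ha m), fun κ _ φ hφ => ?_⟩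
  rw [map_mul, map_prod] at hφ
  have hφ0 := left_ne_zero_of_mul hφ
  have hφa := Finset.prod_ne_zero_iff.mp (right_ne_zero_of_mul hφ)
  have hc : (map φ g).coeff m₀ ≠ 0 := by rwa [coeff_map]
  have hg0 : map φ g ≠ 0 := fun h => hc (by rw [h, coeff_zero])
  refine ⟨not_isUnit_of_coeff_ne_zero hm₀ hc, fun p q hpq => ?_⟩
  by_contra! hu
  have hp0 : p ≠ 0 := by rintro rfl; simp at hpq; exact hg0 hpq
  have hq0 : q ≠ 0 := by rintro rfl; simp at hpq; exact hg0 hpq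
  have hdeg : p.totalDegree + q.totalDegree ≤ d := by
    rw [← totalDegree_mul_of_isDomain hp0 hq0, ← hpq]
    exact Finset.sup_mono (support_map_subset φ g)
  obtain ⟨m₁, hm₁, hc₁⟩ := exists_coeff_ne_zero_of_not_isUnit hp0 hu.1
  obtain ⟨m₂, hm₂, hc₂⟩ := exists_coeff_ne_zero_of_not_isUnit hq0 hu.2
  have hM {f : MvPolynomial σ κ} (hf : f.totalDegree ≤ d) {m : σ →₀ ℕ} (hm : m ≠ 0)
      (hc : f.coeff m ≠ 0) : m ∈ M := by
    refine Finset.mem_erase.mpr ⟨hm, ?_⟩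
    simp only [Set.Finite.mem_toFinset, Set.mem_ofPred_eq]
    refine le_trans ?_ hf
    exact le_totalDegree (mem_support_iff.mpr hc)
  exact hc₂ (hA (⟨m₁, hM (by omega) hm₁ hc₁⟩, ⟨m₂, hM (by omega) hm₂ hc₂⟩) κ φ
    (hφa _ (Finset.mem_univ _)) p q hpq.symm (by omega) (by omega) hc₁)

end Elimination

/-! ### Extensions with relatively algebraically closed base field -/

section RegularExtension

open MvPolynomial IntermediateField

attribute [local instance] MvPolynomial.algebraMvPolynomial

variable {L K E : Type*} [Field L] [Field K] [Field E] [Algebra L K] [Algebra K E] [Algebra L E]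
  [IsScalarTower L K E]

/-- If `L` is relatively algebraically closed in `K`, minimal polynomials over `L` stay minimal over
`K`: the coefficients of a monic factor over `K` are integral over `L`. -/
lemma minpoly_eq_map_of_algClosedIn (hL : ∀ x : K, IsAlgebraic L x → x ∈ (algebraMap L K).range)
    {θ : E} (hθ : IsIntegral L θ) : minpoly K θ = (minpoly L θ).map (algebraMap L K) := by
  have hdvd : minpoly K θ ∣ (minpoly L θ).map (algebraMap L K) :=
    minpoly.dvd_map_of_isScalarTower _ _ _
  have hmon : (minpoly K θ).Monic := minpoly.monic hθ.tower_top
  have hcoeff (i : ℕ) : (minpoly K θ).coeff i ∈ (algebraMap L K).range :=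
    hL _ (Polynomial.isIntegral_coeff_of_dvd _ _ (minpoly.monic hθ) hmon hdvd i).isAlgebraic
  obtain ⟨q, hq, -, -⟩ := Polynomial.lifts_and_degree_eq_and_monic
    ((Polynomial.lifts_iff_coeff_lifts _).mpr hcoeff) hmon
  have hq0 : Polynomial.aeval θ q = 0 := by
    rw [← Polynomial.aeval_map_algebraMap K, hq, minpoly.aeval]
  refine Polynomial.eq_of_monic_of_associated hmon ((minpoly.monic hθ).map _)
    (associated_of_dvd_dvd hdvd ?_)
  rw [← hq]
  exact Polynomial.map_dvd _ (minpoly.dvd L θ hq0)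

/-- If `L` is relatively algebraically closed in `K`, the extension `K` is linearly disjoint from
the algebraic extensions of `L`. By the theorem of the primitive element this reduces to
`minpoly_eq_map_of_algClosedIn`. -/
lemma linearIndependent_of_algClosedIn [CharZero L]
    (hL : ∀ x : K, IsAlgebraic L x → x ∈ (algebraMap L K).range)
    {ι : Type*} {ω : ι → E} (hω : ∀ i, IsIntegral L (ω i)) (hli : LinearIndependent L ω) :
    LinearIndependent K ω := by
  rw [linearIndependent_iff_finset_linearIndependent] at hli ⊢
  intro s
  let F : IntermediateField L E := adjoin L (Set.range fun i : s => ω i)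
  have hfin : FiniteDimensional L F :=
    finiteDimensional_adjoin (by rintro _ ⟨i, rfl⟩; exact hω i)
  obtain ⟨θ, hθ⟩ := Field.exists_primitive_element L F
  have hθi : IsIntegral L θ := IsIntegral.of_finite L θ
  have hθE : IsIntegral L (θ : E) := hθi.map F.val
  have hmin : (minpoly K (θ : E)).natDegree = (minpoly L θ).natDegree := by
    rw [minpoly_eq_map_of_algClosedIn hL hθE, Polynomial.natDegree_map]
    exact congrArg Polynomial.natDegree (minpoly.algHom_eq F.val F.val.injective θ)
  let pb : PowerBasis L F := PowerBasis.ofAdjoinEqTop' hθi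
    (by
      rw [← adjoin_simple_toSubalgebra_of_isAlgebraic hθi.isAlgebraic, hθ, top_toSubalgebra])
  have hpb : LinearIndependent K (F.val ∘ pb.basis) := by
    have h := linearIndependent_pow (K := K) (θ : E)
    have hd : pb.dim = (minpoly K (θ : E)).natDegree := by
      rw [hmin]; simp [pb]
    have h2 := h.comp (Fin.cast hd) (Fin.cast_injective hd)
    convert h2 using 1
    ext i
    simp only [Function.comp_apply, PowerBasis.coe_basis, map_pow, Fin.val_cast]
    rw [PowerBasis.ofAdjoinEqTop'_gen]
    rfl
  have hdis : F.LinearDisjoint K := LinearDisjoint.of_basis_left pb.basis hpb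
  let a : s → F := fun i => ⟨ω i, subset_adjoin _ _ ⟨i, rfl⟩⟩
  have ha : LinearIndependent L a := by
    refine LinearIndependent.of_comp F.val.toLinearMap ?_
    exact hli s
  exact hdis.linearIndependent_left ha

/-- If `g` generates the ideal of relations over `A` of a family `y` of elements of `K`, and the
field of fractions `L` of `A` is relatively algebraically closed in `K`, then `g` is prime over the
algebraic closure of `L`: by linear disjointness it generates the ideal of relations over it too. -/
theorem prime_map_algebraicClosure [CharZero L]
    (hL : ∀ x : K, IsAlgebraic L x → x ∈ (algebraMap L K).range)
    {A σ : Type*} [CommRing A] [IsDomain A] [Algebra A L] [IsFractionRing A L] [Algebra A K]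
    [IsScalarTower A L K]
    (y : σ → K) {g : MvPolynomial σ A} (hg0 : g ≠ 0) (hgy : aeval y g = 0)
    (hker : ∀ f : MvPolynomial σ A, aeval y f = 0 → g ∣ f) :
    Prime (map ((algebraMap L (algebraicClosure L E)).comp (algebraMap A L)) g) := by
  classical
  set Ω := algebraicClosure L E
  set j : A →+* Ω := (algebraMap L Ω).comp (algebraMap A L)
  let ev : MvPolynomial σ Ω →ₐ[Ω] E := aeval (fun i => algebraMap K E (y i))
  have hev (f : MvPolynomial σ L) : ev (map (algebraMap L Ω) f) = algebraMap K E (aeval y f) := by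
    simp only [ev, aeval_map_algebraMap]
    rw [← IsScalarTower.coe_toAlgHom' L K E, ← AlgHom.comp_apply, comp_aeval]
  have hjm (f : MvPolynomial σ A) : map j f = map (algebraMap L Ω) (map (algebraMap A L) f) := by
    rw [MvPolynomial.map_map]
  have hevA (f : MvPolynomial σ A) : ev (map j f) = algebraMap K E (aeval y f) := by
    rw [hjm, hev, aeval_map_algebraMap]
  have hevg : ev (map j g) = 0 := by rw [hevA, hgy, map_zero]
  have hjinj : Function.Injective j :=
    (algebraMap L Ω).injective.comp (IsFractionRing.injective A L)
  have hdvdL (f : MvPolynomial σ L) (hf : aeval y f = 0) :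
      map j g ∣ map (algebraMap L Ω) f := by
    obtain ⟨⟨f', ⟨_, c, hc, rfl⟩⟩, hf'⟩ := IsLocalization.surj
      ((nonZeroDivisors A).map (C (σ := σ))) f
    have hf'' : f * C (algebraMap A L c) = map (algebraMap A L) f' := by
      have h1 : f * map (algebraMap A L) (C c) = map (algebraMap A L) f' := hf'
      rwa [map_C] at h1
    have hf0 : aeval y f' = 0 := by
      rw [← aeval_map_algebraMap L, ← hf'', map_mul, hf, zero_mul]
    have hc0 : algebraMap A L c ≠ 0 := by
      simpa using nonZeroDivisors.ne_zero hc
    have h1 := map_dvd (map j) (hker f' hf0)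
    rw [hjm f', ← hf'', map_mul, map_C] at h1
    refine (IsUnit.dvd_mul_right ?_).mp h1
    exact (IsUnit.mk0 _ (by simpa using hc0)).map C
  have hdvd (f : MvPolynomial σ Ω) (hf : ev f = 0) : map j g ∣ f := by
    -- expand the coefficients of `f` in a basis of `Ω` over `L`, which stays independent over `K`
    let b := Module.Basis.ofVectorSpace L Ω
    let S := f.support.biUnion fun m => (b.repr (f.coeff m)).support
    let p (i) : MvPolynomial σ L := ∑ m ∈ f.support, monomial m (b.repr (f.coeff m) i)
    have hsum : f = ∑ i ∈ S, C (b i) * map (algebraMap L Ω) (p i) := by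
      have : ∀ m ∈ f.support, f.coeff m = ∑ i ∈ S, b i * algebraMap L Ω (b.repr (f.coeff m) i) := by
        intro m hm
        conv_lhs => rw [← b.linearCombination_repr (f.coeff m), Finsupp.linearCombination_apply]
        rw [Finsupp.sum]
        simp_rw [Algebra.smul_def, mul_comm]
        refine Finset.sum_subset (Finset.subset_biUnion_of_mem
          (fun m => (b.repr (f.coeff m)).support) hm) fun i _ hi => ?_
        rw [Finsupp.notMem_support_iff.mp hi, map_zero, zero_mul]
      conv_lhs => rw [f.as_sum]
      simp only [p, map_sum, map_monomial, Finset.mul_sum, C_mul_monomial]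
      rw [Finset.sum_comm]
      refine Finset.sum_congr rfl fun m hm => ?_
      conv_lhs => rw [this m hm, map_sum]
    have hb : LinearIndependent K (fun i => (b i : E)) :=
      linearIndependent_of_algClosedIn hL
        (fun i => mem_algebraicClosure_iff'.mp (b i).2)
        (b.linearIndependent.map' Ω.val.toLinearMap (LinearMap.ker_eq_bot.mpr Ω.val.injective))
    have h0 : ∑ i ∈ S, (aeval y (p i)) • (b i : E) = 0 := by
      rw [← hf]
      conv_rhs => rw [hsum]
      rw [map_sum]
      refine Finset.sum_congr rfl fun i _ => ?_
      rw [map_mul, hev, Algebra.smul_def, mul_comm]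
      congr 1
      simp [ev]
    rw [hsum]
    refine Finset.dvd_sum fun i hi => Dvd.dvd.mul_left (hdvdL _ ?_) _
    exact linearIndependent_iff'.mp hb S _ h0 i hi
  refine ⟨?_, ?_, ?_⟩
  · rwa [Ne, map_eq_zero_iff _ (map_injective _ hjinj)]
  · intro hu
    simpa [hevg] using hu.map ev
  · rintro p q ⟨r, hr⟩
    have h : ev p * ev q = 0 := by rw [← map_mul, hr, map_mul, hevg, zero_mul]
    exact (mul_eq_zero.mp h).imp (hdvd p) (hdvd q)

end RegularExtension

/-! ### Integral primitive elements -/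

section PrimitiveElement

open Polynomial

variable {R F K B : Type*} [CommRing R] [IsDomain R] [Field F] [Algebra R F] [IsFractionRing R F]
  [CommRing B] [IsDomain B] [Algebra R B] [Field K] [Algebra B K] [IsFractionRing B K]
  [Algebra F K] [Algebra R K] [IsScalarTower R F K] [IsScalarTower R B K]

variable (R F) in
lemma exists_smul_eq_map (p : F[X]) :
    ∃ c : R, c ≠ 0 ∧ ∃ q : R[X], q.map (algebraMap R F) = c • p := by
  obtain ⟨c, hc, h⟩ := IsLocalization.integerNormalization_spec (nonZeroDivisors R) p
  exact ⟨c, nonZeroDivisors.ne_zero hc, _, h⟩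

omit [IsDomain R] [IsFractionRing R F] [IsDomain B] [IsFractionRing B K] in
variable (F K) in
lemma algebraMap_aeval (t : B) (f : R[X]) :
    algebraMap B K (aeval t f) = aeval (algebraMap B K t) (f.map (algebraMap R F)) := by
  rw [aeval_map_algebraMap, aeval_algebraMap_apply]

omit [IsDomain R] [IsDomain B] in
lemma aeval_eq_zero_iff_dvd_of_map_eq_minpoly {t : B} {g : R[X]} (hg : g.Monic)
    (hmin : g.map (algebraMap R F) = minpoly F (algebraMap B K t)) (f : R[X]) :
    aeval t f = 0 ↔ g ∣ f := by
  rw [← map_dvd_map _ (IsFractionRing.injective R F) hg, hmin, minpoly.dvd_iff,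
    ← algebraMap_aeval F K, map_eq_zero_iff _ (IsFractionRing.injective B K)]

variable (R F K B) in
/-- There is a primitive element of `K / F` that lies in `B` and whose minimal polynomial has
coefficients in `R`: multiply a given one by a common denominator. -/
lemma exists_primitive_generator [Algebra.FiniteType R B] [Algebra.IsAlgebraic F K] [CharZero F] :
    ∃ (t : B) (g : R[X]), g.Monic ∧ g.map (algebraMap R F) = minpoly F (algebraMap B K t) ∧
      IntermediateField.adjoin F {algebraMap B K t} = ⊤ := by
  have : Algebra.EssFiniteType B K := .of_isLocalization _ (nonZeroDivisors B)
  have : Algebra.EssFiniteType R K := .comp R B K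
  have : Algebra.EssFiniteType F K := .of_comp R F K
  have : Module.Finite F K := Algebra.finite_of_essFiniteType_of_isAlgebraic
  have hRK : Algebra.IsAlgebraic R K :=
    IsFractionRing.comap_isAlgebraic_iff (A := R) (K := F).mpr inferInstance
  have hRB : Algebra.IsAlgebraic R B := ⟨fun b => by
    have := hRK.isAlgebraic (algebraMap B K b)
    rwa [isAlgebraic_algebraMap_iff (IsFractionRing.injective B K)] at this⟩
  obtain ⟨θ, hθ⟩ := Field.exists_primitive_element F K
  obtain ⟨p, s, hs, rfl⟩ := IsFractionRing.div_surjective (A := B) θ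
  obtain ⟨c, hc, q, hq⟩ := (hRB.isAlgebraic s).exists_nonzero_dvd hs
  set θ := algebraMap B K p / algebraMap B K s
  have hs0 : algebraMap B K s ≠ 0 := by simpa using nonZeroDivisors.ne_zero hs
  have hcθ : algebraMap B K (p * q) = algebraMap R K c * θ := by
    rw [IsScalarTower.algebraMap_apply R B K, hq, map_mul, map_mul]
    simp only [θ]
    field_simp
  let P := minpoly F θ
  let d : R := IsLocalization.commonDenom (nonZeroDivisors R) P.support P.coeff
  have hd : d ≠ 0 := nonZeroDivisors.ne_zero (Subtype.coe_prop _)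
  have hlead : ∀ Q : F[X], Q.Monic → Q.leadingCoeff ∈ (algebraMap R F).range := fun Q h => by
    rw [h.leadingCoeff]; exact one_mem _
  have hθi : IsIntegral F θ := .of_finite F θ
  have hPm : P.Monic := minpoly.monic hθi
  obtain ⟨g₁, hg₁, -, hg₁m⟩ := lifts_and_natDegree_eq_and_monic
    (IsLocalization.scaleRoots_commonDenom_mem_lifts (nonZeroDivisors R) P (hlead _ hPm))
    ((monic_scaleRoots_iff _).mpr hPm)
  refine ⟨algebraMap R B d * (p * q), g₁.scaleRoots c, (monic_scaleRoots_iff _).mpr hg₁m, ?_, ?_⟩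
  all_goals
    have ht : algebraMap B K (algebraMap R B d * (p * q)) = algebraMap R F (d * c) • θ := by
      rw [map_mul, hcθ, ← IsScalarTower.algebraMap_apply, map_mul, Algebra.smul_def, map_mul,
        ← IsScalarTower.algebraMap_apply, ← IsScalarTower.algebraMap_apply, mul_assoc]
    have hdc : algebraMap R F (d * c) ≠ 0 := by simpa using ⟨hd, hc⟩
  · rw [ht, IsIntegrallyClosed.minpoly_smul hdc hθi, map_mul, scaleRoots_mul, ← hg₁,
      map_scaleRoots _ _ _ (by simp [hg₁m.leadingCoeff])]
  · rw [ht, eq_top_iff, ← hθ, IntermediateField.adjoin_simple_le_iff]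
    have h := IntermediateField.mem_adjoin_simple_self F (algebraMap R F (d * c) • θ)
    have h2 := IntermediateField.smul_mem _ h (x := (algebraMap R F (d * c))⁻¹)
    rwa [smul_smul, inv_mul_cancel₀ hdc, one_smul] at h2

omit [IsDomain B] in
lemma exists_pow_mul_mem_range_of_adjoin_eq_top [Algebra.FiniteType R B] [Algebra.IsAlgebraic F K]
    {t : B} (ht : IntermediateField.adjoin F {algebraMap B K t} = ⊤) :
    ∃ h : R, h ≠ 0 ∧ ∀ b : B, ∃ (n : ℕ) (f : R[X]), algebraMap R B h ^ n * b = aeval t f := by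
  classical
  have key (b : B) : ∃ c : R, c ≠ 0 ∧ ∃ f : R[X], algebraMap R B c * b = aeval t f := by
    have hb : algebraMap B K b ∈ Algebra.adjoin F {algebraMap B K t} := by
      rw [← IntermediateField.adjoin_simple_toSubalgebra_of_isAlgebraic
        (Algebra.IsAlgebraic.isAlgebraic _), ht]
      trivial
    rw [Algebra.adjoin_singleton_eq_range_aeval] at hb
    obtain ⟨p, hp⟩ := hb
    obtain ⟨c, hc, f, hf⟩ := exists_smul_eq_map R F p
    refine ⟨c, hc, f, IsFractionRing.injective B K ?_⟩
    rw [algebraMap_aeval F K, hf, map_mul, ← IsScalarTower.algebraMap_apply, ← hp]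
    simp [Algebra.smul_def, IsScalarTower.algebraMap_apply R F K]
  choose c hc f hf using key
  obtain ⟨S, hS⟩ := (inferInstance : Algebra.FiniteType R B)
  let h := ∏ s ∈ S, c s
  refine ⟨h, Finset.prod_ne_zero_iff.mpr fun s _ => hc s, fun b => ?_⟩
  have hb : b ∈ Algebra.adjoin R (S : Set B) := hS ▸ Algebra.mem_top
  induction hb using Algebra.adjoin_induction with
  | mem s hs =>
    refine ⟨1, C (∏ s ∈ S.erase s, c s) * f s, ?_⟩
    rw [map_mul, ← hf, aeval_C, pow_one, ← mul_assoc, ← map_mul, Finset.prod_erase_mul _ _ hs]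
  | algebraMap r => exact ⟨0, C r, by simp⟩
  | add x y _ _ hx hy =>
    obtain ⟨n, p, hp⟩ := hx
    obtain ⟨m, q, hq⟩ := hy
    refine ⟨n + m, C h ^ m * p + C h ^ n * q, ?_⟩
    simp only [map_add, map_mul, map_pow, aeval_C, ← hp, ← hq]
    ring
  | mul x y _ _ hx hy =>
    obtain ⟨n, p, hp⟩ := hx
    obtain ⟨m, q, hq⟩ := hy
    refine ⟨n + m, p * q, ?_⟩
    rw [map_mul, ← hp, ← hq]
    ring

omit [IsDomain B] [Algebra R B] [IsFractionRing B K] [Algebra R K] [IsScalarTower R F K]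
  [IsScalarTower R B K] in
/-- Separability of the minimal polynomial, with denominators cleared. -/
lemma exists_bezout_derivative [Algebra.IsAlgebraic F K] [CharZero F] {t : B} {g : R[X]}
    (hmin : g.map (algebraMap R F) = minpoly F (algebraMap B K t)) :
    ∃ h : R, h ≠ 0 ∧ ∃ u v : R[X], derivative g * u + g * v = C h := by
  have hsep : (g.map (algebraMap R F)).Separable := by
    rw [hmin]
    exact (minpoly.irreducible (Algebra.IsAlgebraic.isAlgebraic _).isIntegral).separable
  obtain ⟨a, b, hab⟩ := hsep
  obtain ⟨c, hc, a', ha'⟩ := exists_smul_eq_map R F a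
  obtain ⟨d, hd, b', hb'⟩ := exists_smul_eq_map R F b
  refine ⟨c * d, mul_ne_zero hc hd, C c * b', C d * a',
    map_injective _ (IsFractionRing.injective R F) ?_⟩
  simp only [Polynomial.map_add, Polynomial.map_mul, ha', hb', map_C, ← derivative_map, map_mul]
  simp only [Algebra.smul_def, Polynomial.algebraMap_apply]
  linear_combination (C (algebraMap R F c) * C (algebraMap R F d)) * hab

end PrimitiveElement

/-! ### Hypersurface charts -/

section Chart

open Polynomial

/-- Evaluation of polynomials in `t` over `A[x]` at elements of an `A`-algebra. -/
noncomputable def evalHom {σ A B : Type*} [CommRing A] [CommRing B] [Algebra A B] (x : σ → B)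
    (t : B) : (MvPolynomial σ A)[X] →+* B :=
  eval₂RingHom (MvPolynomial.aeval x : MvPolynomial σ A →ₐ[A] B).toRingHom t

section EvalHom

variable {σ A B : Type*} [CommRing A] [CommRing B] [Algebra A B] (x : σ → B) (t : B)

@[simp] lemma evalHom_C (p : MvPolynomial σ A) : evalHom x t (C p) = MvPolynomial.aeval x p := by
  simp [evalHom]

@[simp] lemma evalHom_X : evalHom (A := A) x t X = t := by
  simp [evalHom]

lemma evalHom_map {A' B' : Type*} [CommRing A'] [CommRing B'] [Algebra A' B'] (φ : A →+* A')
    (ψ : B →+* B') (h : ψ.comp (algebraMap A B) = (algebraMap A' B').comp φ)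
    (f : (MvPolynomial σ A)[X]) :
    evalHom (ψ ∘ x) (ψ t) (f.map (MvPolynomial.map φ)) = ψ (evalHom x t f) := by
  have : (evalHom (ψ ∘ x) (ψ t)).comp (mapRingHom (MvPolynomial.map φ)) =
      ψ.comp (evalHom x t : (MvPolynomial σ A)[X] →+* B) := by
    ext a
    · simpa using! (congr($h a)).symm
    · simp
    · simp
  exact congr($this f)

lemma evalHom_optionEquivLeft (f : MvPolynomial (Option σ) A) :
    evalHom x t (MvPolynomial.optionEquivLeft A σ f) =
      MvPolynomial.aeval (fun i : Option σ => i.elim t x) f := by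
  have : (evalHom x t).comp (MvPolynomial.optionEquivLeft A σ).toRingEquiv.toRingHom =
      (MvPolynomial.aeval (fun i : Option σ => i.elim t x) : _ →ₐ[A] B).toRingHom := by
    ext i
    · simp
    · cases i <;> simp
  exact congr($this f)

lemma optionEquivLeft_map {A' : Type*} [CommRing A'] (φ : A →+* A')
    (f : MvPolynomial (Option σ) A) :
    MvPolynomial.optionEquivLeft A' σ (MvPolynomial.map φ f) =
      (MvPolynomial.optionEquivLeft A σ f).map (MvPolynomial.map φ) := by
  have : (MvPolynomial.optionEquivLeft A' σ).toRingEquiv.toRingHom.comp (MvPolynomial.map φ) =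
      (mapRingHom (MvPolynomial.map φ)).comp
        (MvPolynomial.optionEquivLeft A σ).toRingEquiv.toRingHom := by
    ext i
    · simp
    · cases i <;> simp
  exact congr($this f)

end EvalHom

/-- A presentation of the `A`-algebra `B`, up to inverting a polynomial `h` in the variables `x`, as
`A[x][t] / (g)` with `g` monic in `t` and with `∂g/∂t` a divisor of `h` modulo `g`. The element `h`
is not required to be invertible, or even nonzero, in `B`. -/
structure HypersurfaceChart (σ A B : Type*) [CommRing A] [CommRing B] [Algebra A B] where
  x : σ → B
  t : B
  g : (MvPolynomial σ A)[X]
  h : MvPolynomial σ A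
  monic : g.Monic
  evalHom_eq_zero_iff : ∀ f, evalHom x t f = 0 ↔ g ∣ f
  exists_pow_mul : ∀ b : B, ∃ (n : ℕ) (f : (MvPolynomial σ A)[X]),
    MvPolynomial.aeval x h ^ n * b = evalHom x t f
  bezout : ∃ u v, derivative g * u + g * v = C h

lemma trdeg_eq_of_isFractionRing {A B L K : Type u} [CommRing A] [CommRing B] [IsDomain A]
    [IsDomain B] [Field L] [Field K] [Algebra A B] [Algebra A L] [Algebra A K] [Algebra B K]
    [Algebra L K] [IsScalarTower A B K] [IsScalarTower A L K] [IsFractionRing A L]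
    [IsFractionRing B K] : Algebra.trdeg A B = Algebra.trdeg L K := by
  have : FaithfulSMul A L := inferInstance
  have : FaithfulSMul B K := inferInstance
  have : FaithfulSMul A K := by
    rw [faithfulSMul_iff_algebraMap_injective, IsScalarTower.algebraMap_eq A L K]
    exact (algebraMap L K).injective.comp (IsFractionRing.injective A L)
  have : FaithfulSMul A B := by
    rw [faithfulSMul_iff_algebraMap_injective]
    have h := FaithfulSMul.algebraMap_injective A K
    rw [IsScalarTower.algebraMap_eq A B K] at h
    exact Function.Injective.of_comp h
  have h1 := trdeg_add_eq A L (A := K)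
  have h2 := trdeg_add_eq A B (A := K)
  have : Algebra.IsAlgebraic A L := IsLocalization.isAlgebraic L (nonZeroDivisors A)
  have : Algebra.IsAlgebraic B K := IsLocalization.isAlgebraic K (nonZeroDivisors B)
  rw [trdeg_eq_zero, zero_add] at h1
  rw [trdeg_eq_zero (R := B), add_zero] at h2
  rw [h1, h2]

/-- Choose a transcendence basis of `B` over `A` and a primitive element of `K` over the field of
rational functions in it, scaled to be integral over the polynomial ring. -/
theorem exists_hypersurfaceChart {A B L K : Type u} [CommRing A] [CommRing B] [IsDomain A]
    [IsDomain B] [Field L] [Field K] [Algebra A B] [Algebra A L] [Algebra A K] [Algebra B K]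
    [Algebra L K] [IsScalarTower A B K] [IsScalarTower A L K] [IsFractionRing A L]
    [IsFractionRing B K] [CharZero L] [Algebra.FiniteType A B] {r : ℕ}
    (hr : (r : Cardinal) = Algebra.trdeg L K) :
    ∃ c : HypersurfaceChart (Fin r) A B, c.h ≠ 0 := by
  have hAK : Function.Injective (algebraMap A K) := by
    rw [IsScalarTower.algebraMap_eq A L K]
    exact (algebraMap L K).injective.comp (IsFractionRing.injective A L)
  have : FaithfulSMul A B := by
    rw [faithfulSMul_iff_algebraMap_injective]
    rw [IsScalarTower.algebraMap_eq A B K] at hAK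
    exact Function.Injective.of_comp hAK
  obtain ⟨s, hs⟩ := exists_isTranscendenceBasis A B
  have hcard : Cardinal.mk s = r := by
    rw [hs.cardinalMk_eq_trdeg, trdeg_eq_of_isFractionRing (L := L) (K := K), hr]
  obtain ⟨e⟩ : Nonempty (Fin r ≃ s) := by
    rw [← Cardinal.lift_mk_eq', hcard]
    simp
  let x : Fin r → B := fun i => e i
  have hx : IsTranscendenceBasis A x := hs.comp_equiv e
  let R := MvPolynomial (Fin r) A
  let _ : Algebra R B := (MvPolynomial.aeval x).toAlgebra
  have hRB : Function.Injective (algebraMap R B) := hx.1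
  let _ : Algebra R K := ((algebraMap B K).comp (algebraMap R B)).toAlgebra
  have : IsScalarTower R B K := .of_algebraMap_eq fun _ => rfl
  have : IsScalarTower A R B := .of_algebraMap_eq fun a => by
    simp [R, RingHom.algebraMap_toAlgebra]
  have : FaithfulSMul R K := by
    rw [faithfulSMul_iff_algebraMap_injective, IsScalarTower.algebraMap_eq R B K]
    exact (IsFractionRing.injective B K).comp hRB
  let F := FractionRing R
  let _ : Algebra F K := FractionRing.liftAlgebra R K
  have : IsScalarTower R F K := inferInstance
  have : Algebra.FiniteType R B := .of_restrictScalars_finiteType A R B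
  have : Algebra.IsAlgebraic R B := by
    have := hx.isAlgebraic
    refine Algebra.IsAlgebraic.of_ringHom_of_comp_eq hx.1.aevalEquiv.toRingEquiv.toRingHom
      (RingHom.id B) hx.1.aevalEquiv.surjective Function.injective_id ?_
    ext p
    · simp [RingHom.algebraMap_toAlgebra]
    · simp [RingHom.algebraMap_toAlgebra]
  have : Algebra.IsAlgebraic R K := by
    have : Algebra.IsAlgebraic B K := IsLocalization.isAlgebraic K (nonZeroDivisors B)
    exact .trans R B K
  have : Algebra.IsAlgebraic F K := IsFractionRing.comap_isAlgebraic_iff (A := R).mp inferInstance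
  have : CharZero F := by
    have : CharZero K := charZero_of_injective_algebraMap (algebraMap L K).injective
    exact (algebraMap F K).charZero
  obtain ⟨t, g, hg, hmin, htop⟩ := exists_primitive_generator R F K B
  obtain ⟨h₁, h₁0, hspan⟩ := exists_pow_mul_mem_range_of_adjoin_eq_top (R := R) htop
  obtain ⟨h₂, h₂0, u, v, huv⟩ := exists_bezout_derivative hmin
  have hev (f : R[X]) : evalHom x t f = aeval t f := by
    simp [evalHom, aeval_def]; rfl
  refine ⟨⟨x, t, g, h₁ * h₂, hg, fun f => ?_, fun b => ?_, C h₁ * u, C h₁ * v, ?_⟩,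
    mul_ne_zero h₁0 h₂0⟩
  · rw [hev]; exact aeval_eq_zero_iff_dvd_of_map_eq_minpoly hg hmin f
  · obtain ⟨n, f, hf⟩ := hspan b
    refine ⟨n, C (h₂ ^ n) * f, ?_⟩
    have h1 : evalHom x t (C (h₂ ^ n) * f) =
        MvPolynomial.aeval x h₂ ^ n * (MvPolynomial.aeval x h₁ ^ n * b) := by
      rw [hev, map_mul, ← hf, aeval_C, map_pow]
      rfl
    rw [h1, map_mul, mul_pow]
    ring
  · rw [C_mul, ← huv]; ring

/-- If `L` is relatively algebraically closed in `K`, the equation of a hypersurface chart is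
irreducible over every field to which `A[1/a]` maps, for some `a ≠ 0`. -/
theorem exists_forall_irreducible_map {A B L K : Type u} [CommRing A] [CommRing B] [IsDomain A]
    [IsDomain B] [Field L] [Field K] [Algebra A B] [Algebra A L] [Algebra A K] [Algebra B K]
    [Algebra L K] [IsScalarTower A B K] [IsScalarTower A L K] [IsFractionRing A L]
    [IsFractionRing B K] [CharZero L]
    (hL : ∀ x : K, IsAlgebraic L x → x ∈ (algebraMap L K).range)
    {σ : Type*} [Finite σ] (c : HypersurfaceChart σ A B) :
    ∃ a : A, a ≠ 0 ∧ ∀ (κ : Type u) [Field κ] (φ : A →+* κ), φ a ≠ 0 →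
      Irreducible (c.g.map (MvPolynomial.map φ)) := by
  let E := AlgebraicClosure K
  let G := (MvPolynomial.optionEquivLeft A σ).symm c.g
  have hG : MvPolynomial.optionEquivLeft A σ G = c.g := AlgEquiv.apply_symm_apply _ _
  let y : Option σ → K := fun i => algebraMap B K (i.elim c.t c.x)
  have hy (f : MvPolynomial (Option σ) A) : MvPolynomial.aeval y f =
      algebraMap B K (evalHom c.x c.t (MvPolynomial.optionEquivLeft A σ f)) := by
    rw [evalHom_optionEquivLeft, ← MvPolynomial.aeval_algebraMap_apply]
    rfl
  have hprime := prime_map_algebraicClosure (E := E) hL (A := A) y (g := G)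
    (by simpa [G] using c.monic.ne_zero)
    (by rw [hy, hG, (c.evalHom_eq_zero_iff _).mpr dvd_rfl, map_zero])
    (fun f hf => by
      rw [hy, map_eq_zero_iff _ (IsFractionRing.injective B K), c.evalHom_eq_zero_iff, ← hG] at hf
      exact (map_dvd_iff _).mp hf)
  have : IsAlgClosed (algebraicClosure L E) := (algebraicClosure.isAlgClosure L E).isAlgClosed
  let _ : Algebra A (algebraicClosure L E) :=
    ((algebraMap L (algebraicClosure L E)).comp (algebraMap A L)).toAlgebra
  have : IsScalarTower A L (algebraicClosure L E) := .of_algebraMap_eq fun _ => rfl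
  obtain ⟨a, ha, H⟩ := exists_ne_zero_forall_irreducible_map.{u} (L := L) (g := G)
    hprime.irreducible
  refine ⟨a, ha, fun κ _ φ hφ => ?_⟩
  have := H κ φ hφ
  rwa [← MulEquiv.irreducible_iff (MvPolynomial.optionEquivLeft κ σ), optionEquivLeft_map,
    hG] at this

end Chart

/-! ### Localization of hypersurface charts -/

section ChartLocalization

open Polynomial

attribute [local instance] MvPolynomial.algebraMvPolynomial Polynomial.algebra in
lemma exists_pow_mul_eq_map {A A' σ : Type*} [CommRing A] [CommRing A'] [Algebra A A'] (a : A)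
    [IsLocalization.Away a A'] (f : (MvPolynomial σ A')[X]) :
    ∃ (n : ℕ) (f₀ : (MvPolynomial σ A)[X]),
      C (MvPolynomial.C (algebraMap A A' a ^ n)) * f =
        f₀.map (MvPolynomial.map (algebraMap A A')) := by
  let M := (Submonoid.powers a).map (MvPolynomial.C (σ := σ))
  have : IsLocalization (M.map C) (MvPolynomial σ A')[X] :=
    Polynomial.isLocalization M (MvPolynomial σ A')
  obtain ⟨⟨f₀, ⟨_, _, ⟨_, ⟨n, rfl⟩, rfl⟩, rfl⟩⟩, hf⟩ := IsLocalization.surj (M.map C) f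
  refine ⟨n, f₀, ?_⟩
  have h : f * (C (MvPolynomial.C (a ^ n))).map (MvPolynomial.map (algebraMap A A')) =
    f₀.map (MvPolynomial.map (algebraMap A A')) := hf
  rw [← h, mul_comm, map_C, MvPolynomial.map_C]
  simp only [map_pow]

variable {σ A B : Type*} [CommRing A] [CommRing B] [Algebra A B] (c : HypersurfaceChart σ A B)
  {A' B' : Type*} [CommRing A'] [CommRing B'] [Algebra A A'] [Algebra B B'] [Algebra A' B']
  [Algebra A B'] [IsScalarTower A B B'] [IsScalarTower A A' B']

lemma evalHom_map_algebraMap (x : σ → B) (t : B) (f : (MvPolynomial σ A)[X]) :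
    evalHom (fun i => algebraMap B B' (x i)) (algebraMap B B' t)
      (f.map (MvPolynomial.map (algebraMap A A'))) = algebraMap B B' (evalHom x t f) :=
  evalHom_map x t (algebraMap A A') (algebraMap B B')
    (by rw [← IsScalarTower.algebraMap_eq, ← IsScalarTower.algebraMap_eq]) f

lemma aeval_map_algebraMap' (x : σ → B) (p : MvPolynomial σ A) :
    MvPolynomial.aeval (fun i => algebraMap B B' (x i)) (MvPolynomial.map (algebraMap A A') p) =
      algebraMap B B' (MvPolynomial.aeval x p) := by
  have := evalHom_map_algebraMap (A' := A') (B' := B') x 0 (C p)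
  simpa using this

/-- The base change of a chart to `A[1/a] → B[1/(a h)]`. -/
noncomputable def HypersurfaceChart.localize [IsDomain B] (a : A)
    (hb : algebraMap A B a * MvPolynomial.aeval c.x c.h ≠ 0) [IsLocalization.Away a A']
    [IsLocalization.Away (algebraMap A B a * MvPolynomial.aeval c.x c.h) B'] :
    HypersurfaceChart σ A' B' where
  x i := algebraMap B B' (c.x i)
  t := algebraMap B B' c.t
  g := c.g.map (MvPolynomial.map (algebraMap A A'))
  h := MvPolynomial.map (algebraMap A A') c.h
  monic := c.monic.map _
  evalHom_eq_zero_iff f := by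
    have hinj : Function.Injective (algebraMap B B') :=
      IsLocalization.injective B' (powers_le_nonZeroDivisors_of_noZeroDivisors hb)
    constructor
    · intro hf
      obtain ⟨n, f₀, h⟩ := exists_pow_mul_eq_map a f
      have h0 : evalHom c.x c.t f₀ = 0 := by
        apply hinj
        rw [← evalHom_map_algebraMap (A' := A'), ← h, map_mul, hf, mul_zero, map_zero]
      have h1 := map_dvd (mapRingHom (MvPolynomial.map (algebraMap A A')))
        ((c.evalHom_eq_zero_iff _).mp h0)
      simp only [coe_mapRingHom] at h1
      rw [← h] at h1
      refine (IsUnit.dvd_mul_left ?_).mp h1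
      exact (((IsLocalization.Away.algebraMap_isUnit a).pow n).map MvPolynomial.C).map C
    · rintro ⟨q, rfl⟩
      rw [map_mul, evalHom_map_algebraMap, (c.evalHom_eq_zero_iff _).mpr dvd_rfl, map_zero,
        zero_mul]
  exists_pow_mul b' := by
    obtain ⟨n, b, hb'⟩ :=
      IsLocalization.Away.surj (algebraMap A B a * MvPolynomial.aeval c.x c.h) b'
    obtain ⟨m, f, hf⟩ := c.exists_pow_mul b
    obtain ⟨u, hu⟩ := (IsLocalization.Away.algebraMap_isUnit (S := A') a).pow n
    refine ⟨n + m,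
      C (MvPolynomial.C ((u⁻¹ : A'ˣ) : A')) * f.map (MvPolynomial.map (algebraMap A A')), ?_⟩
    rw [map_mul, evalHom_map_algebraMap, ← hf, aeval_map_algebraMap', evalHom_C, map_mul, ← hb',
      map_mul, mul_pow, MvPolynomial.aeval_C, ← IsScalarTower.algebraMap_apply,
      IsScalarTower.algebraMap_apply A A' B', ← map_pow (algebraMap A' B'), ← hu]
    have : algebraMap A' B' ((u⁻¹ : A'ˣ) : A') * algebraMap A' B' u = 1 := by
      rw [← map_mul, Units.inv_mul, map_one]
    rw [map_pow]
    linear_combination (-(algebraMap B B' (MvPolynomial.aeval c.x c.h)) ^ (n + m) * b') * this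
  bezout := by
    obtain ⟨u, v, huv⟩ := c.bezout
    refine ⟨u.map (MvPolynomial.map (algebraMap A A')),
      v.map (MvPolynomial.map (algebraMap A A')), ?_⟩
    rw [derivative_map, ← Polynomial.map_mul, ← Polynomial.map_mul, ← Polynomial.map_add,
      huv, map_C]

lemma HypersurfaceChart.isUnit_localize [IsDomain B] (a : A)
    (hb : algebraMap A B a * MvPolynomial.aeval c.x c.h ≠ 0) [IsLocalization.Away a A']
    [IsLocalization.Away (algebraMap A B a * MvPolynomial.aeval c.x c.h) B'] :
    IsUnit (MvPolynomial.aeval (c.localize (A' := A') (B' := B') a hb).x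
      (c.localize (A' := A') (B' := B') a hb).h) := by
  have h : IsUnit (algebraMap B B' (algebraMap A B a * MvPolynomial.aeval c.x c.h)) :=
    IsLocalization.Away.algebraMap_isUnit _
  rw [map_mul] at h
  change IsUnit (MvPolynomial.aeval (fun i => algebraMap B B' (c.x i))
    (MvPolynomial.map (algebraMap A A') c.h))
  rw [aeval_map_algebraMap']
  exact isUnit_of_mul_isUnit_right h

end ChartLocalization

/-! ### Smoothness and fibres of hypersurface charts -/

section Smooth

open Polynomial

lemma isStandardSmoothOfRelativeDimension_mvPolynomial (A : Type*) [CommRing A] [Nontrivial A]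
    (r : ℕ) : Algebra.IsStandardSmoothOfRelativeDimension r A (MvPolynomial (Fin r) A) := by
  have : Algebra.IsStandardSmooth A (MvPolynomial (Fin r) A) :=
    .of_basis_kaehlerDifferential (KaehlerDifferential.mvPolynomialBasis A (Fin r)) (by
      rintro _ ⟨i, rfl⟩
      exact ⟨MvPolynomial.X i, by simp⟩)
  rw [Algebra.IsStandardSmoothOfRelativeDimension.iff_of_isStandardSmooth,
    rank_eq_card_basis (KaehlerDifferential.mvPolynomialBasis A (Fin r)), Fintype.card_fin]

variable {σ A B : Type*} [CommRing A] [CommRing B] [Algebra A B] (c : HypersurfaceChart σ A B)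

/-- The map `A[x][t] / (g) → B` of a hypersurface chart. -/
noncomputable def HypersurfaceChart.ofAdjoinRoot : AdjoinRoot c.g →+* B :=
  AdjoinRoot.lift (MvPolynomial.aeval c.x : MvPolynomial σ A →ₐ[A] B).toRingHom c.t
    ((c.evalHom_eq_zero_iff c.g).mpr dvd_rfl)

lemma HypersurfaceChart.ofAdjoinRoot_mk (f : (MvPolynomial σ A)[X]) :
    c.ofAdjoinRoot (AdjoinRoot.mk c.g f) = evalHom c.x c.t f :=
  AdjoinRoot.lift_mk _ f

lemma HypersurfaceChart.isLocalization_away (hu : IsUnit (MvPolynomial.aeval c.x c.h)) :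
    letI := c.ofAdjoinRoot.toAlgebra
    IsLocalization.Away (AdjoinRoot.mk c.g (C c.h)) B := by
  let _ := c.ofAdjoinRoot.toAlgebra
  have hmk (f : (MvPolynomial σ A)[X]) :
      algebraMap (AdjoinRoot c.g) B (AdjoinRoot.mk c.g f) = evalHom c.x c.t f :=
    c.ofAdjoinRoot_mk f
  refine (isLocalization_iff _ _).mpr ⟨?_, fun b => ?_, fun {p q} hpq => ⟨1, ?_⟩⟩
  · rintro ⟨_, n, rfl⟩
    simp only [map_pow, hmk, evalHom_C]
    exact hu.pow n
  · obtain ⟨n, f, hf⟩ := c.exists_pow_mul b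
    refine ⟨(AdjoinRoot.mk c.g f, ⟨_, n, rfl⟩), ?_⟩
    simp only [map_pow, hmk, evalHom_C, ← hf, mul_comm b]
  · obtain ⟨p, rfl⟩ := AdjoinRoot.mk_surjective p
    obtain ⟨q, rfl⟩ := AdjoinRoot.mk_surjective q
    rw [hmk, hmk, ← sub_eq_zero, ← map_sub, c.evalHom_eq_zero_iff] at hpq
    rw [AdjoinRoot.mk_eq_mk.mpr hpq]

/-- Where `h` is invertible, a hypersurface chart is a standard étale algebra over `A[x]`. -/
theorem HypersurfaceChart.etale (hu : IsUnit (MvPolynomial.aeval c.x c.h)) :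
    letI := (MvPolynomial.aeval c.x : MvPolynomial σ A →ₐ[A] B).toAlgebra
    Algebra.Etale (MvPolynomial σ A) B := by
  let _ := (MvPolynomial.aeval c.x : MvPolynomial σ A →ₐ[A] B).toAlgebra
  let P : StandardEtalePair (MvPolynomial σ A) :=
    ⟨c.g, c.monic, C c.h, by
      obtain ⟨u, v, huv⟩ := c.bezout
      exact ⟨u, v, 1, by rw [huv, pow_one]⟩⟩
  let _ := c.ofAdjoinRoot.toAlgebra
  have : IsScalarTower (MvPolynomial σ A) (AdjoinRoot c.g) B := .of_algebraMap_eq fun p => by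
    have := c.ofAdjoinRoot_mk (C p)
    rw [evalHom_C] at this
    exact this.symm
  have := c.isLocalization_away hu
  let e : Localization.Away (AdjoinRoot.mk c.g (C c.h)) ≃ₐ[AdjoinRoot c.g] B :=
    IsLocalization.algEquiv (Submonoid.powers (AdjoinRoot.mk c.g (C c.h))) _ _
  exact .of_equiv (P.equivAwayAdjoinRoot.trans (e.restrictScalars (MvPolynomial σ A)))

open TensorProduct in
/-- The base change of `B` to a field `κ` embeds into the field of fractions of `κ[x][t] / (g)`. -/
theorem HypersurfaceChart.isDomain_tensorProduct (hu : IsUnit (MvPolynomial.aeval c.x c.h))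
    {κ : Type*} [Field κ] [Algebra A κ]
    (hg : Irreducible (c.g.map (MvPolynomial.map (algebraMap A κ))))
    (hh : MvPolynomial.map (algebraMap A κ) c.h ≠ 0) : IsDomain (κ ⊗[A] B) := by
  set g := c.g.map (MvPolynomial.map (algebraMap A κ)) with hgdef
  have hgm : g.Monic := c.monic.map _
  have : IsDomain (AdjoinRoot g) := AdjoinRoot.isDomain_of_prime hg.prime
  obtain ⟨Q, _, toQ, htoQ⟩ : ∃ (Q : Type _) (_ : Field Q) (toQ : AdjoinRoot g →+* Q),
      Function.Injective toQ :=
    ⟨FractionRing (AdjoinRoot g), inferInstance, algebraMap _ _, IsFractionRing.injective _ _⟩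
  let χ : AdjoinRoot c.g →+* AdjoinRoot g :=
    AdjoinRoot.lift ((AdjoinRoot.of g).comp (MvPolynomial.map (algebraMap A κ)))
      (AdjoinRoot.root g) (by rw [← eval₂_map]; exact AdjoinRoot.eval₂_root g)
  have hχ (f : (MvPolynomial σ A)[X]) : χ (AdjoinRoot.mk c.g f) =
      AdjoinRoot.mk g (f.map (MvPolynomial.map (algebraMap A κ))) := by
    simp only [χ, AdjoinRoot.lift_mk]
    rw [← eval₂_map, ← AdjoinRoot.aeval_eq]
    rfl
  have hh' : AdjoinRoot.mk g (C (MvPolynomial.map (algebraMap A κ) c.h)) ≠ 0 := by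
    rw [Ne, AdjoinRoot.mk_eq_zero]
    intro hdvd
    have h1 := natDegree_le_of_dvd hdvd (C_ne_zero.mpr hh)
    rw [natDegree_C, nonpos_iff_eq_zero, hgm.natDegree_eq_zero] at h1
    exact hg.not_isUnit (h1 ▸ isUnit_one)
  let _ := c.ofAdjoinRoot.toAlgebra
  have hloc := c.isLocalization_away hu
  have hunit : IsUnit ((toQ.comp χ) (AdjoinRoot.mk c.g (C c.h))) := by
    refine IsUnit.mk0 _ ?_
    rw [RingHom.comp_apply, hχ, map_C]
    exact (map_ne_zero_iff _ htoQ).mpr hh'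
  let β : B →+* Q := IsLocalization.Away.lift (AdjoinRoot.mk c.g (C c.h)) hunit
  have hβ (f : (MvPolynomial σ A)[X]) : β (evalHom c.x c.t f) =
      toQ (AdjoinRoot.mk g (f.map (MvPolynomial.map (algebraMap A κ)))) := by
    rw [← hχ, ← c.ofAdjoinRoot_mk]
    exact IsLocalization.Away.lift_eq _ hunit _
  let γ : κ →+* Q := toQ.comp ((AdjoinRoot.of g).comp MvPolynomial.C)
  let _ : Algebra κ Q := γ.toAlgebra
  let _ : Algebra A Q := (γ.comp (algebraMap A κ)).toAlgebra
  have : IsScalarTower A κ Q := .of_algebraMap_eq fun _ => rfl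
  let βA : B →ₐ[A] Q := { β with
    commutes' := fun a => by
      have := hβ (C (MvPolynomial.C a))
      rw [evalHom_C, MvPolynomial.aeval_C, map_C, MvPolynomial.map_C] at this
      exact this }
  let ψ : κ ⊗[A] B →ₐ[κ] Q := Algebra.TensorProduct.lift (Algebra.ofId κ Q) βA (fun _ _ => .all _ _)
  let x' : σ → κ ⊗[A] B := fun i => 1 ⊗ₜ c.x i
  let t' : κ ⊗[A] B := 1 ⊗ₜ c.t
  have hΦ (f : (MvPolynomial σ A)[X]) : evalHom x' t' (f.map (MvPolynomial.map (algebraMap A κ))) =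
      1 ⊗ₜ evalHom c.x c.t f :=
    evalHom_map c.x c.t (algebraMap A κ)
      (Algebra.TensorProduct.includeRight : B →ₐ[A] κ ⊗[A] B).toRingHom
      (by
        ext a
        simp [Algebra.TensorProduct.algebraMap_apply]) f
  have hψ (f : (MvPolynomial σ κ)[X]) : ψ (evalHom x' t' f) = toQ (AdjoinRoot.mk g f) := by
    have : ψ.toRingHom.comp (evalHom x' t') = toQ.comp (AdjoinRoot.mk g) := by
      ext i
      · suffices ψ (i ⊗ₜ[A] 1) = toQ (AdjoinRoot.of g (MvPolynomial.C i)) by simpa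
        rw [Algebra.TensorProduct.lift_tmul, map_one, mul_one]
        rfl
      · have : βA (c.x i) = toQ (AdjoinRoot.of g (MvPolynomial.X i)) := by
          exact (by simpa using hβ (C (MvPolynomial.X i)) :
            β (c.x i) = toQ (AdjoinRoot.of g (MvPolynomial.X i)))
        simpa [ψ, x'] using this
      · have : βA c.t = toQ (AdjoinRoot.root g) :=
          (by simpa using hβ X : β c.t = toQ (AdjoinRoot.root g))
        simpa [ψ, t'] using this
    exact congr($this f)
  have hspan (z : κ ⊗[A] B) : ∃ (n : ℕ) (f : (MvPolynomial σ κ)[X]),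
      (1 ⊗ₜ MvPolynomial.aeval c.x c.h) ^ n * z = evalHom x' t' f := by
    have hH : (1 ⊗ₜ MvPolynomial.aeval c.x c.h : κ ⊗[A] B) =
        evalHom x' t' ((C c.h).map (MvPolynomial.map (algebraMap A κ))) := by
      rw [hΦ, evalHom_C]
    induction z with
    | zero => exact ⟨0, 0, by simp⟩
    | tmul l b =>
      obtain ⟨n, f, hf⟩ := c.exists_pow_mul b
      refine ⟨n, C (MvPolynomial.C l) * f.map (MvPolynomial.map (algebraMap A κ)), ?_⟩
      rw [map_mul, hΦ, ← hf, evalHom_C, MvPolynomial.aeval_C]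
      simp [Algebra.TensorProduct.algebraMap_apply]
    | add z w hz hw =>
      obtain ⟨n, p, hp⟩ := hz
      obtain ⟨m, q, hq⟩ := hw
      refine ⟨n + m, (C c.h).map (MvPolynomial.map (algebraMap A κ)) ^ m * p +
        (C c.h).map (MvPolynomial.map (algebraMap A κ)) ^ n * q, ?_⟩
      rw [map_add, map_mul, map_mul, map_pow, map_pow, ← hH, ← hp, ← hq]
      ring
  have hinj : Function.Injective ψ := by
    rw [injective_iff_map_eq_zero]
    intro z hz
    obtain ⟨n, f, hf⟩ := hspan z
    have h0 : toQ (AdjoinRoot.mk g f) = 0 := by rw [← hψ, ← hf, map_mul, hz, mul_zero]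
    rw [map_eq_zero_iff _ htoQ, AdjoinRoot.mk_eq_zero] at h0
    obtain ⟨q, rfl⟩ := h0
    have hg0 : evalHom x' t' g = 0 := by
      rw [hgdef, hΦ, (c.evalHom_eq_zero_iff _).mpr dvd_rfl, tmul_zero]
    rw [map_mul, hg0, zero_mul] at hf
    have hu' : IsUnit (1 ⊗ₜ MvPolynomial.aeval c.x c.h : κ ⊗[A] B) :=
      hu.map (Algebra.TensorProduct.includeRight : B →ₐ[A] κ ⊗[A] B)
    exact (hu'.pow n).mul_right_eq_zero.mp hf
  exact hinj.isDomain ψ.toRingHom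

theorem HypersurfaceChart.isStandardSmoothOfRelativeDimension [Nontrivial A] {r : ℕ}
    (c : HypersurfaceChart (Fin r) A B) (hu : IsUnit (MvPolynomial.aeval c.x c.h)) :
    Algebra.IsStandardSmoothOfRelativeDimension r A B := by
  let _ := (MvPolynomial.aeval c.x : MvPolynomial (Fin r) A →ₐ[A] B).toAlgebra
  have : IsScalarTower A (MvPolynomial (Fin r) A) B := .of_algebraMap_eq fun a => by
    simp [RingHom.algebraMap_toAlgebra]
  have : Algebra.IsStandardSmoothOfRelativeDimension 0 (MvPolynomial (Fin r) A) B :=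
    Algebra.Etale.iff_isStandardSmoothOfRelativeDimension_zero.mp (c.etale hu)
  have := isStandardSmoothOfRelativeDimension_mvPolynomial A r
  simpa using Algebra.IsStandardSmoothOfRelativeDimension.trans r 0 A (MvPolynomial (Fin r) A) B

end Smooth

/-! ### Smooth localizations with integral geometric fibres -/

section SpreadingOut

open TensorProduct

lemma HypersurfaceChart.tensorProduct_of_localize {A B : Type u} [CommRing A] [CommRing B]
    [IsDomain B] [Algebra A B] {r : ℕ} (c : HypersurfaceChart (Fin r) A B) {a : A}
    (hb : algebraMap A B a * MvPolynomial.aeval c.x c.h ≠ 0)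
    (hirr : ∀ (κ : Type u) [Field κ] (φ : A →+* κ), φ a ≠ 0 →
      Irreducible (c.g.map (MvPolynomial.map φ)))
    (hh : ∀ (κ : Type u) [Field κ] (φ : A →+* κ), φ a ≠ 0 → MvPolynomial.map φ c.h ≠ 0)
    (A' B' : Type u) [CommRing A'] [CommRing B'] [Algebra A A'] [Algebra B B'] [Algebra A' B']
    [Algebra A B'] [IsScalarTower A B B'] [IsScalarTower A A' B'] [IsLocalization.Away a A']
    [IsLocalization.Away (algebraMap A B a * MvPolynomial.aeval c.x c.h) B']
    (κ : Type u) [Field κ] [Algebra A' κ] : IsDomain (κ ⊗[A'] B') := by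
  have ha : ((algebraMap A' κ).comp (algebraMap A A')) a ≠ 0 :=
    ((IsLocalization.Away.algebraMap_isUnit (S := A') a).map (algebraMap A' κ)).ne_zero
  have hcomp : MvPolynomial.map ((algebraMap A' κ).comp (algebraMap A A')) =
      (MvPolynomial.map (algebraMap A' κ)).comp
        (MvPolynomial.map (σ := Fin r) (algebraMap A A')) :=
    RingHom.ext fun p => (MvPolynomial.map_map _ _ p).symm
  refine (c.localize (A' := A') (B' := B') a hb).isDomain_tensorProduct
    (c.isUnit_localize a hb) (κ := κ) ?_ ?_
  · have := hirr κ _ ha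
    rwa [hcomp, ← Polynomial.map_map] at this
  · have := hh κ _ ha
    rwa [hcomp] at this

lemma faithfullyFlat_of_isStandardSmoothOfRelativeDimension {A B : Type u} [CommRing A]
    [CommRing B] [Algebra A B] (r : ℕ) [Algebra.IsStandardSmoothOfRelativeDimension r A B]
    (h : ∀ (κ : Type u) [Field κ] [Algebra A κ], Nontrivial (κ ⊗[A] B)) :
    Module.FaithfullyFlat A B := by
  have := Algebra.IsStandardSmoothOfRelativeDimension.isStandardSmooth (R := A) (S := B) r
  have : Module.Flat A B := inferInstance
  rw [Module.FaithfullyFlat.iff_flat_and_proper_ideal]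
  refine ⟨this, fun I hI htop => ?_⟩
  obtain ⟨m, hm, hIm⟩ := Ideal.exists_le_maximal I hI
  let _ := Ideal.Quotient.field m
  have := h (A ⧸ m)
  refine one_ne_zero (α := (A ⧸ m) ⊗[A] B) ?_
  let ι : B →ₐ[A] (A ⧸ m) ⊗[A] B := Algebra.TensorProduct.includeRight
  have hle : m.map (algebraMap A B) ≤ RingHom.ker ι := by
    rw [Ideal.map_le_iff_le_comap]
    intro a ha
    rw [Ideal.mem_comap, RingHom.mem_ker, AlgHom.commutes, Algebra.TensorProduct.algebraMap_apply,
      Ideal.Quotient.algebraMap_eq, Ideal.Quotient.eq_zero_iff_mem.mpr ha, zero_tmul]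
  rw [Ideal.smul_top_eq_map, Submodule.restrictScalars_eq_top_iff] at htop
  have h1 : (1 : B) ∈ m.map (algebraMap A B) :=
    Ideal.map_mono hIm ((Ideal.eq_top_iff_one _).mp htop)
  simpa using! hle h1

/-- Generic smoothness with integral geometric fibres, for an algebra of finite type over a domain
of characteristic zero whose field of fractions is relatively algebraically closed. The conclusion
is stated for arbitrary models `A'` of `A[1/a]` and `B'` of `B[1/b]`. -/
theorem exists_smooth_localization {A B L K : Type u} [CommRing A] [CommRing B] [IsDomain A]
    [IsDomain B] [Field L] [Field K] [Algebra A B] [Algebra A L] [Algebra A K] [Algebra B K]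
    [Algebra L K] [IsScalarTower A B K] [IsScalarTower A L K] [IsFractionRing A L]
    [IsFractionRing B K] [CharZero L] [Algebra.FiniteType A B] {r : ℕ}
    (hr : (r : Cardinal) = Algebra.trdeg L K)
    (hL : ∀ x : K, IsAlgebraic L x → x ∈ (algebraMap L K).range) :
    ∃ (a : A) (b : B), b ≠ 0 ∧ algebraMap A B a ∣ b ∧
      ∀ (A' B' : Type u) [CommRing A'] [CommRing B'] [Algebra A A'] [Algebra B B'] [Algebra A' B']
        [Algebra A B'] [IsScalarTower A B B'] [IsScalarTower A A' B'] [IsLocalization.Away a A']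
        [IsLocalization.Away b B'],
        Algebra.IsStandardSmoothOfRelativeDimension r A' B' ∧
        ∀ (κ : Type u) [Field κ] [Algebra A' κ], IsDomain (κ ⊗[A'] B') := by
  obtain ⟨c, hc⟩ := exists_hypersurfaceChart (A := A) (B := B) (L := L) (K := K) hr
  obtain ⟨a₀, ha₀, hirr⟩ := exists_forall_irreducible_map (L := L) (K := K) hL c
  obtain ⟨m, hm⟩ := MvPolynomial.ne_zero_iff.mp hc
  have hinj : Function.Injective (algebraMap A B) := by
    have hAK : Function.Injective (algebraMap A K) := by
      rw [IsScalarTower.algebraMap_eq A L K]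
      exact (algebraMap L K).injective.comp (IsFractionRing.injective A L)
    rw [IsScalarTower.algebraMap_eq A B K] at hAK
    exact Function.Injective.of_comp hAK
  have hb : algebraMap A B (a₀ * c.h.coeff m) * MvPolynomial.aeval c.x c.h ≠ 0 := by
    refine mul_ne_zero ((map_ne_zero_iff _ hinj).mpr (mul_ne_zero ha₀ hm)) ?_
    rw [← evalHom_C c.x c.t, Ne, c.evalHom_eq_zero_iff]
    intro hdvd
    have h1 := Polynomial.natDegree_le_of_dvd hdvd (Polynomial.C_ne_zero.mpr hc)
    rw [Polynomial.natDegree_C, nonpos_iff_eq_zero, c.monic.natDegree_eq_zero] at h1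
    have h0 := (c.evalHom_eq_zero_iff c.g).mpr dvd_rfl
    rw [h1, map_one] at h0
    exact one_ne_zero h0
  -- inverting a coefficient of `c.h` keeps `c.h` nonzero over all fields
  refine ⟨a₀ * c.h.coeff m, _, hb, dvd_mul_right _ _, ?_⟩
  intro A' B' _ _ _ _ _ _ _ _ _ _
  have : Nontrivial A' := 
    (IsLocalization.injective A' (powers_le_nonZeroDivisors_of_noZeroDivisors
      (mul_ne_zero ha₀ hm))).nontrivial
  refine ⟨(c.localize (A' := A') (B' := B') _ hb).isStandardSmoothOfRelativeDimension
    (c.isUnit_localize _ hb), fun κ _ _ => ?_⟩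
  refine c.tensorProduct_of_localize hb (fun κ _ φ hφ => hirr κ φ ?_)
    (fun κ _ φ hφ h0 => ?_) A' B' κ
  · rw [map_mul] at hφ
    exact left_ne_zero_of_mul hφ
  · rw [map_mul, ← MvPolynomial.coeff_map, h0] at hφ
    simp at hφ

/-- Under a faithfully flat extension `A' → B'` of domains, a fraction that lies in `B'` lies in
`A'`, because `q B' ∩ A' = q A'`. -/
lemma exists_algebraMap_eq_of_mul_eq {A A' B' : Type*} [CommRing A] [CommRing A'] [CommRing B']
    [IsDomain B'] [Algebra A A'] [Algebra A' B'] [Algebra A B']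
    [IsScalarTower A A' B'] [Module.FaithfullyFlat A' B'] {p q : A} {x : B'}
    (hq : algebraMap A B' q ≠ 0) (h : algebraMap A B' q * x = algebraMap A B' p) :
    ∃ y : A', algebraMap A' B' y = x := by
  have hp : algebraMap A A' p ∈ Ideal.span {algebraMap A A' q} := by
    rw [← Ideal.comap_map_eq_self_of_faithfullyFlat (B := B') (Ideal.span {algebraMap A A' q}),
      Ideal.mem_comap, Ideal.map_span, Set.image_singleton, Ideal.mem_span_singleton,
      ← IsScalarTower.algebraMap_apply, ← IsScalarTower.algebraMap_apply]
    exact ⟨x, h.symm⟩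
  obtain ⟨y, hy⟩ := Ideal.mem_span_singleton.mp hp
  refine ⟨y, mul_left_cancel₀ hq ?_⟩
  rw [h, IsScalarTower.algebraMap_apply A A' B', IsScalarTower.algebraMap_apply A A' B' p, hy,
    map_mul]

end SpreadingOut

/-! ### Constants of a derivation -/

section Constants

open Polynomial

/-- In characteristic zero, a derivation into a torsion-free module kills every element algebraic
over a ring of constants. -/
lemma map_eq_zero_of_isAlgebraic {B M : Type*} [CommRing B] [IsDomain B] [CharZero B]
    [AddCommGroup M] [Module B M] (D : B →+ M)
    (leibniz : ∀ x y, D (x * y) = x • D y + y • D x)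
    (torsionFree : ∀ (b : B) (m : M), b • m = 0 → b = 0 ∨ m = 0) (A : Subring B)
    (hA : ∀ a ∈ A, D a = 0) {b : B} (hb : IsAlgebraic A b) : D b = 0 := by
  let Δ : Derivation A B M := .mk'
    { D with
      map_smul' := fun a x => by
        change D (a.1 * x) = a.1 • D x
        rw [leibniz, hA _ a.2, smul_zero, add_zero] } leibniz
  have hΔ (x : B) : Δ x = D x := rfl
  -- a polynomial of least degree killing `b` has a derivative that does not kill `b`
  have hex : ∃ n : ℕ, ∃ p : A[X], p ≠ 0 ∧ aeval b p = 0 ∧ p.natDegree = n := by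
    obtain ⟨p, hp, h⟩ := hb
    exact ⟨_, p, hp, h, rfl⟩
  classical
  obtain ⟨p, hp, h, hdeg⟩ := Nat.find_spec hex
  have hpos : p.natDegree ≠ 0 := by
    intro h0
    obtain ⟨c, rfl⟩ := natDegree_eq_zero.mp h0
    rw [aeval_C, map_eq_zero_iff _ (FaithfulSMul.algebraMap_injective A B)] at h
    exact hp (by rw [h, C_0])
  have hd0 : derivative p ≠ 0 := fun h0 => hpos (derivative_eq_zero.mp h0)
  have hne : aeval b (derivative p) ≠ 0 := by
    intro h0
    have := Nat.find_min' hex ⟨derivative p, hd0, h0, rfl⟩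
    rw [← hdeg] at this
    exact absurd (natDegree_derivative_lt hpos) this.not_gt
  have := Δ.map_aeval p b
  rw [h, map_zero, hΔ] at this
  exact (torsionFree _ _ this.symm).resolve_left hne

end Constants

/-! ### Fields of fractions and generators -/

section FieldOfFractions

/-- If `L` is algebraic over `A` and `B` is normal with `B ∩ L = A`, then `L` is the field of
fractions of `A`. -/
lemma isFractionRing_of_isAlgebraic {A B L K : Type*} [CommRing A] [CommRing B] [IsDomain B]
    [Field L] [Field K] [Algebra A B] [Algebra A L] [Algebra A K] [Algebra B K]
    [Algebra L K] [IsScalarTower A B K] [IsScalarTower A L K] [IsFractionRing B K]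
    [IsIntegrallyClosed B] [FaithfulSMul A L] (halg : ∀ l : L, IsAlgebraic A l)
    (hA : ∀ (b : B) (l : L), algebraMap B K b = algebraMap L K l → b ∈ (algebraMap A B).range) :
    IsFractionRing A L := by
  have : IsDomain A := (FaithfulSMul.algebraMap_injective A L).isDomain
  refine IsFractionRing.of_field A L fun l => ?_
  obtain ⟨c, hc, hint⟩ := (halg l).exists_integral_multiple
  have hK : IsIntegral B (algebraMap L K (c • l)) :=
    (hint.map (IsScalarTower.toAlgHom A L K)).tower_top
  obtain ⟨b, hb⟩ := IsIntegrallyClosed.isIntegral_iff.mp hK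
  obtain ⟨a, rfl⟩ := hA b _ hb
  refine ⟨a, c, ?_⟩
  have hc' : algebraMap A L c ≠ 0 :=
    (map_ne_zero_iff _ (FaithfulSMul.algebraMap_injective A L)).mpr hc
  rw [eq_div_iff hc', mul_comm, ← Algebra.smul_def]
  apply (algebraMap L K).injective
  rw [← hb, ← IsScalarTower.algebraMap_apply, ← IsScalarTower.algebraMap_apply]

/-- A subextension `L` of a finitely generated field extension `K / k` has finite transcendence
degree over `k`. -/
lemma exists_finite_isAlgebraic_adjoin (k B : Type u) {L K : Type u} [Field k] [CommRing B]
    [IsDomain B] [Field L] [Field K] [Algebra k B] [Algebra k L] [Algebra k K] [Algebra B K]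
    [Algebra L K] [IsScalarTower k B K] [IsScalarTower k L K] [IsFractionRing B K]
    [Algebra.FiniteType k B] :
    ∃ s : Set L, s.Finite ∧ ∀ l : L, IsAlgebraic (Algebra.adjoin k s) l := by
  have hlt : Algebra.trdeg k L < Cardinal.aleph0 := by
    obtain ⟨n, φ, hφ⟩ := Algebra.FiniteType.iff_quotient_mvPolynomial''.mp ‹Algebra.FiniteType k B›
    calc Algebra.trdeg k L ≤ Algebra.trdeg k K :=
          trdeg_le_of_injective (IsScalarTower.toAlgHom k L K) (algebraMap L K).injective
      _ = Algebra.trdeg k B := (trdeg_eq_of_isFractionRing (A := k) (L := k)).symm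
      _ ≤ Algebra.trdeg k (MvPolynomial (Fin n) k) := trdeg_le_of_surjective φ hφ
      _ = n := by simp
      _ < _ := Cardinal.natCast_lt_aleph0
  obtain ⟨s, hs⟩ := exists_isTranscendenceBasis k L
  refine ⟨s, ?_, fun l => ?_⟩
  · rw [← Cardinal.lt_aleph0_iff_set_finite, hs.cardinalMk_eq_trdeg]
    exact hlt
  · have := hs.isAlgebraic
    rw [Subtype.range_coe] at this
    exact this.isAlgebraic l

lemma isAlgebraic_of_adjoin_le {k A L : Type*} [CommRing k] [CommRing A] [CommRing L] [Algebra k A]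
    [Algebra k L] [Algebra A L] [IsScalarTower k A L] {s : Set L}
    (hs : s ⊆ (algebraMap A L).range) {l : L} (hl : IsAlgebraic (Algebra.adjoin k s) l) :
    IsAlgebraic A l := by
  let φ := IsScalarTower.toAlgHom k A L
  have h := hl.tower_top_of_subalgebra_le (B := φ.range) (Algebra.adjoin_le hs)
  exact h.of_ringHom_of_comp_eq φ.rangeRestrict.toRingHom (RingHom.id L)
    φ.rangeRestrict_surjective Function.injective_id rfl

end FieldOfFractions

/-! ### Localizing the ring of first integrals -/

section Descent

/-- If `A'` consists of those fractions of elements of `A` that lie in `B'`, and `A[1/a] → B'` is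
faithfully flat, then `A' = A[1/a]`. -/
lemma isLocalization_away_of_faithfullyFlat {A A' B' : Type*} [CommRing A] [CommRing A']
    [CommRing B'] [IsDomain B'] [Algebra A A'] [Algebra A' B'] [Algebra A B']
    [IsScalarTower A A' B'] [FaithfulSMul A' B'] [FaithfulSMul A B'] {a : A}
    (ha : IsUnit (algebraMap A A' a))
    (hfrac : ∀ x : A', ∃ p q : A, q ≠ 0 ∧ algebraMap A A' q * x = algebraMap A A' p)
    (hflat : ∀ [Algebra (Localization.Away a) B'] [IsScalarTower A (Localization.Away a) B'],
      Module.FaithfullyFlat (Localization.Away a) B') :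
    IsLocalization.Away a A' := by
  have hA : Function.Injective (algebraMap A B') := FaithfulSMul.algebraMap_injective A B'
  have hA' : Function.Injective (algebraMap A' B') := FaithfulSMul.algebraMap_injective A' B'
  have haB : IsUnit (algebraMap A B' a) := by
    rw [IsScalarTower.algebraMap_apply A A' B']
    exact ha.map _
  let _ : Algebra (Localization.Away a) B' := (IsLocalization.Away.lift a haB).toAlgebra
  have : IsScalarTower A (Localization.Away a) B' := .of_algebraMap_eq fun x =>
    (IsLocalization.Away.lift_eq a haB x).symm
  have := hflat
  refine (isLocalization_iff _ _).mpr ⟨?_, fun x => ?_, fun {p q} hpq => ⟨1, ?_⟩⟩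
  · rintro ⟨_, n, rfl⟩
    simpa only [map_pow] using ha.pow n
  · obtain ⟨p, q, hq, h⟩ := hfrac x
    have hx : algebraMap A B' q * algebraMap A' B' x = algebraMap A B' p := by
      rw [IsScalarTower.algebraMap_apply A A' B', ← map_mul, h, ← IsScalarTower.algebraMap_apply]
    obtain ⟨y, hy⟩ := exists_algebraMap_eq_of_mul_eq (A' := Localization.Away a)
      ((map_ne_zero_iff _ hA).mpr hq) hx
    obtain ⟨n, z, hz⟩ := IsLocalization.Away.surj a y
    refine ⟨(z, ⟨_, n, rfl⟩), hA' ?_⟩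
    rw [map_mul, ← hy, ← IsScalarTower.algebraMap_apply, ← IsScalarTower.algebraMap_apply,
      IsScalarTower.algebraMap_apply A (Localization.Away a) B', ← map_mul, map_pow, hz,
      ← IsScalarTower.algebraMap_apply]
  · rw [IsScalarTower.algebraMap_eq A A' B', RingHom.coe_comp] at hA
    rw [hA.of_comp hpq]

end Descent

/-! ### Morphisms of affine schemes -/

section Spec

open TensorProduct Limits

lemma smoothOfRelativeDimension_specMap {A B : Type u} [CommRing A] [CommRing B] [Algebra A B]
    (r : ℕ) [Algebra.IsStandardSmoothOfRelativeDimension r A B] :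
    SmoothOfRelativeDimension r (Spec.map (CommRingCat.ofHom (algebraMap A B))) := by
  rw [HasRingHomProperty.Spec_iff (P := @SmoothOfRelativeDimension r)]
  refine RingHom.locally_of RingHom.isStandardSmoothOfRelativeDimension_respectsIso _ ?_
  rw [CommRingCat.hom_ofHom, RingHom.isStandardSmoothOfRelativeDimension_algebraMap]
  infer_instance

lemma geometricallyConnected_specMap {A B : Type u} [CommRing A] [CommRing B] [Algebra A B]
    (h : ∀ (κ : Type u) [Field κ] [Algebra A κ], IsDomain (κ ⊗[A] B)) :
    GeometricallyConnected (Spec.map (CommRingCat.ofHom (algebraMap A B))) := by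
  refine ⟨geometrically_iff_of_commRing.mpr fun κ _ _ Y fst snd hY => ?_⟩
  let e : Y ≅ Spec (.of (κ ⊗[A] B)) :=
    hY.flip.isoPullback ≪≫ pullbackSpecIso A κ B
  have := h κ
  have : ConnectedSpace (Spec (.of (κ ⊗[A] B))) := inferInstance
  exact e.schemeIsoToHomeo.symm.surjective.connectedSpace (by fun_prop)

end Spec

/-! ### Normal schemes locally of finite type over a field -/

section Scheme

lemma isIntegrallyClosed_of_isAffineOpen {X : Scheme.{u}} [IsIntegral X]
    (normal : ∀ x : X, IsIntegrallyClosed (X.presheaf.stalk x))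
    {V : X.Opens} [Nonempty V] (hV : IsAffineOpen V) : IsIntegrallyClosed Γ(X, V) := by
  refine .of_localization_maximal fun p _ hp => ?_
  let y : PrimeSpectrum Γ(X, V) := ⟨p, hp.isPrime⟩
  have hy : hV.fromSpec y ∈ V := (hV.isoSpec.inv y).2
  let _ := TopCat.Presheaf.algebra_section_stalk X.presheaf ⟨hV.fromSpec y, hy⟩
  have : IsLocalization.AtPrime (X.presheaf.stalk (hV.fromSpec y)) p :=
    hV.isLocalization_stalk' y hy
  have := normal (hV.fromSpec y)
  exact .of_equiv (IsLocalization.algEquiv p.primeCompl (X.presheaf.stalk (hV.fromSpec y))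
    (Localization.AtPrime p)).toRingEquiv

lemma finiteType_constants {k : Type u} [Field k] {X : Scheme.{u}}
    {f : X ⟶ Spec (CommRingCat.of k)} [LocallyOfFiniteType f] {V : X.Opens} (hV : IsAffineOpen V) :
    ((constants f).app (op V)).hom.FiniteType := by
  have h := f.finiteType_appLE (isAffineOpen_top _) hV le_top
  have e : (constants f).app (op V) =
    (Scheme.ΓSpecIso (CommRingCat.of k)).inv ≫ f.appLE ⊤ V le_top := rfl
  rw [e, CommRingCat.hom_comp]
  exact h.comp (.of_surjective _ (ConcreteCategory.bijective_of_isIso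
    (Scheme.ΓSpecIso (CommRingCat.of k)).inv).2)

lemma charZero_functionField {k : Type u} [Field k] [CharZero k] {X : Scheme.{u}}
    [IsIntegral X] (f : X ⟶ Spec (CommRingCat.of k)) :
    CharZero X.functionField :=
  have : Nonempty (⊤ : X.Opens) := ⟨⟨genericPoint X, trivial⟩⟩
  let φ : k →+* X.functionField :=
    (X.germToFunctionField ⊤).hom.comp ((constants f).app (op ⊤)).hom
  charZero_of_injective_ringHom φ.injective

end Scheme

/-! ### First integrals on affine open subsets -/

namespace Distribution

variable {k : Type u} [Field k] {X : Scheme.{u}} [IsIntegral X]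
  {f : X ⟶ Spec (CommRingCat.of k)} (F : Distribution f)

/-- The field `𝒪_{X, η}^ℱ` of first integrals at the generic point `η`, as a subfield of the
function field. -/
noncomputable def firstIntegralField : Subfield X.functionField where
  toSubring := F.localFirstIntegrals (genericPoint X)
  inv_mem' s hs := by
    change F.dStalk _ s = 0 at hs
    change F.dStalk _ s⁻¹ = 0
    rcases eq_or_ne s 0 with rfl | h0
    · rwa [inv_zero]
    have h := F.dStalk_mul (genericPoint X) s s⁻¹
    rw [mul_inv_cancel₀ h0, hs, smul_zero, add_zero] at h
    have h1 : F.dStalk (genericPoint X) 1 = 0 := (F.localFirstIntegrals (genericPoint X)).one_mem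
    rw [h1] at h
    exact (smul_eq_zero.mp h.symm).resolve_left h0

lemma trdeg_firstIntegralField (h : F.IsAlgebraicallyIntegrable) :
    (F.rank : Cardinal) = Algebra.trdeg F.firstIntegralField X.functionField := h

lemma mem_firstIntegralField_of_isAlgebraic [CharZero X.functionField] {s : X.functionField}
    (hs : IsAlgebraic F.firstIntegralField s) : s ∈ F.firstIntegralField :=
  map_eq_zero_of_isAlgebraic (F.dStalk (genericPoint X)) (F.dStalk_mul _)
    (fun _ _ => smul_eq_zero.mp) F.firstIntegralField.toSubring (fun _ ha => ha) hs

section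

variable (V : X.Opens) [Nonempty V]

lemma algebraMap_mem_firstIntegralField (a : F.firstIntegrals V) :
    algebraMap (F.firstIntegrals V) X.functionField a ∈ F.firstIntegralField := by
  have h : F.d V a = 0 := a.2
  exact (F.dStalk_germ _ _ _ a.1).trans ((congrArg _ h).trans (map_zero _))

noncomputable instance : Algebra (F.firstIntegrals V) F.firstIntegralField :=
  ((algebraMap (F.firstIntegrals V) X.functionField).codRestrict F.firstIntegralField
    (F.algebraMap_mem_firstIntegralField V)).toAlgebra

instance : IsScalarTower (F.firstIntegrals V) F.firstIntegralField X.functionField :=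
  .of_algebraMap_eq fun _ => rfl

instance : FaithfulSMul Γ(X, V) X.functionField :=
  (faithfulSMul_iff_algebraMap_injective _ _).mpr (X.germToFunctionField_injective V)

instance : FaithfulSMul (F.firstIntegrals V) F.firstIntegralField :=
  (faithfulSMul_iff_algebraMap_injective _ _).mpr fun _ _ h =>
    Subtype.ext (X.germToFunctionField_injective V (congrArg Subtype.val h))

variable {V}

/-- If `𝒪_{X, η}^ℱ` is algebraic over `Γ(V, 𝒪_X^ℱ)`, a function on `V` whose germ at `η` is a first
integral is algebraic over `Γ(V, 𝒪_X^ℱ)`, hence a first integral. -/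
lemma mem_firstIntegrals_of_isAlgebraic [CharZero X.functionField] (hV : IsAffineOpen V)
    (torsionFree : F.IsTorsionFree)
    (halg : ∀ l : F.firstIntegralField, IsAlgebraic (F.firstIntegrals V) l)
    {x : Γ(X, V)} (hx : algebraMap Γ(X, V) X.functionField x ∈ F.firstIntegralField) :
    x ∈ F.firstIntegrals V := by
  have : CharZero Γ(X, V) := (algebraMap Γ(X, V) X.functionField).charZero
  have hK : IsAlgebraic (F.firstIntegrals V) (algebraMap Γ(X, V) X.functionField x) :=
    (halg ⟨_, hx⟩).algebraMap (A := X.functionField)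
  exact map_eq_zero_of_isAlgebraic (F.d V) (F.d_mul V) (torsionFree V hV) (F.firstIntegrals V)
    (fun _ ha => ha)
    ((isAlgebraic_algebraMap_iff (FaithfulSMul.algebraMap_injective _ X.functionField)).mp hK)

end

/-- The restriction map `Γ(V, 𝒪_X^ℱ) → Γ(W, 𝒪_X^ℱ)`. -/
def restrictFirstIntegrals {V W : X.Opens} (h : W ≤ V) :
    F.firstIntegrals V →+* F.firstIntegrals W :=
  ((X.presheaf.map (homOfLE h).op).hom.comp (F.firstIntegrals V).subtype).codRestrict _ fun a => by
    have ha : F.d V a = 0 := a.2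
    exact (F.d_map _ a.1).trans ((congrArg _ ha).trans (map_zero _))

lemma isScalarTower_restrictFirstIntegrals {V W : X.Opens} [Nonempty V] [Nonempty W] (h : W ≤ V) :
    letI := (F.restrictFirstIntegrals h).toAlgebra
    IsScalarTower (F.firstIntegrals V) (F.firstIntegrals W) F.firstIntegralField :=
  letI := (F.restrictFirstIntegrals h).toAlgebra
  .of_algebraMap_eq fun a => Subtype.ext (X.presheaf.germ_res_apply (homOfLE h) _ _ a.1).symm

lemma isAlgebraic_of_le {V W : X.Opens} [Nonempty V] [Nonempty W] (h : W ≤ V)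
    (halg : ∀ l : F.firstIntegralField, IsAlgebraic (F.firstIntegrals V) l)
    (l : F.firstIntegralField) : IsAlgebraic (F.firstIntegrals W) l := by
  let _ := (F.restrictFirstIntegrals h).toAlgebra
  have := F.isScalarTower_restrictFirstIntegrals h
  refine (halg l).extendScalars ?_
  have hinj := FaithfulSMul.algebraMap_injective (F.firstIntegrals V) F.firstIntegralField
  rw [IsScalarTower.algebraMap_eq _ (F.firstIntegrals W), RingHom.coe_comp] at hinj
  exact Function.Injective.of_comp hinj

lemma exists_firstIntegrals_of_mem {s : X.functionField} (hs : s ∈ F.firstIntegralField) :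
    ∃ (V : X.Opens) (hV : genericPoint X ∈ V), ∃ a ∈ F.firstIntegrals V,
      X.presheaf.germ V (genericPoint X) hV a = s := by
  obtain ⟨V, hV, a, rfl⟩ := X.presheaf.exists_germ_eq s
  have h : F.sheaf.presheaf.germ V (genericPoint X) hV (F.d V a) =
      F.sheaf.presheaf.germ V (genericPoint X) hV 0 := by
    rw [map_zero, ← F.dStalk_germ]
    exact hs
  obtain ⟨W, hW, i, j, hij⟩ := TopCat.Presheaf.germ_eq _ _ hV hV _ _ h
  refine ⟨W, hW, X.presheaf.map i.op a, ?_, X.presheaf.germ_res_apply i _ hW a⟩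
  have : F.d W (X.presheaf.map i.op a) = 0 := by
    rw [F.d_map, hij, map_zero]
  exact this

lemma exists_forall_mem_firstIntegrals {s : Set X.functionField} (hfin : s.Finite)
    (hs : ∀ x ∈ s, x ∈ F.firstIntegralField) :
    ∃ (V : X.Opens) (hV : genericPoint X ∈ V), IsAffineOpen V ∧ ∀ x ∈ s,
      ∃ a ∈ F.firstIntegrals V, X.presheaf.germ V (genericPoint X) hV a = x := by
  choose! V hV a ha hax using fun x hx => F.exists_firstIntegrals_of_mem (hs x hx)
  have hfin' : Finite s := hfin
  let W : X.Opens := ⨅ x : s, V x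
  have hW : genericPoint X ∈ W := by
    change genericPoint X ∈ ((⨅ x : s, V x : X.Opens) : Set X)
    rw [Opens.coe_iInf, Set.mem_iInter]
    exact fun x => hV x x.2
  obtain ⟨_, ⟨U, hU, rfl⟩, hxU, hUW⟩ :=
    X.isBasis_affineOpens.exists_subset_of_mem_open hW W.isOpen
  refine ⟨U, hxU, hU, fun x hx => ?_⟩
  have hle : U ≤ V x := le_trans hUW (iInf_le (fun x : s => V x) ⟨x, hx⟩)
  exact ⟨_, (F.restrictFirstIntegrals hle ⟨a x, ha x hx⟩).2,
    (X.presheaf.germ_res_apply (homOfLE hle) _ hxU (a x)).trans (hax x hx)⟩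

/-- The structure of a `k`-algebra on the ring of first integrals. -/
noncomputable instance constAlgebra (U : X.Opens) : Algebra k (F.firstIntegrals U) :=
  (F.constToFirstIntegrals U).toAlgebra

noncomputable instance : Algebra k F.firstIntegralField :=
  have : Nonempty (⊤ : X.Opens) := ⟨⟨genericPoint X, trivial⟩⟩
  ((algebraMap (F.firstIntegrals ⊤) F.firstIntegralField).comp
    (F.constToFirstIntegrals ⊤)).toAlgebra

instance (U : X.Opens) [Nonempty U] :
    IsScalarTower k (F.firstIntegrals U) F.firstIntegralField :=
  have : Nonempty (⊤ : X.Opens) := ⟨⟨genericPoint X, trivial⟩⟩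
  .of_algebraMap_eq fun c => Subtype.ext <| by
    have h := congr($((constants f).naturality (homOfLE (le_top : U ≤ ⊤)).op) c)
    refine (X.presheaf.germ_res_apply (homOfLE (le_top : U ≤ ⊤)) (genericPoint X)
      (((genericPoint_spec X).mem_open_set_iff U.isOpen).mpr (by simpa using ‹Nonempty U›))
      ((constants f).app (op ⊤) c)).symm.trans ?_
    exact congrArg _ h.symm

/-- There is an affine open subset whose ring of first integrals has `𝒪_{X, η}^ℱ` as its field of
fractions. -/
theorem exists_isFractionRing_firstIntegrals [CharZero k] [LocallyOfFiniteType f]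
    (normal : ∀ x : X, IsIntegrallyClosed (X.presheaf.stalk x)) (torsionFree : F.IsTorsionFree) :
    ∃ (V : X.Opens) (_ : Nonempty V), IsAffineOpen V ∧
      Algebra.FiniteType (F.firstIntegrals V) Γ(X, V) ∧
      IsFractionRing (F.firstIntegrals V) F.firstIntegralField ∧
      ∀ l : F.firstIntegralField, IsAlgebraic (F.firstIntegrals V) l := by
  have := charZero_functionField f
  -- a finite set of germs such that all of `L` is algebraic over first integrals including them
  obtain ⟨s, hs, halg⟩ : ∃ s : Set F.firstIntegralField, s.Finite ∧
      ∀ (V : X.Opens) [Nonempty V],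
        s ⊆ (algebraMap (F.firstIntegrals V) F.firstIntegralField).range →
        ∀ l : F.firstIntegralField, IsAlgebraic (F.firstIntegrals V) l := by
    obtain ⟨V, hηV, hV, -⟩ := F.exists_forall_mem_firstIntegrals Set.finite_empty (by simp)
    have : Nonempty V := ⟨⟨_, hηV⟩⟩
    have := functionField_isFractionRing_of_isAffineOpen X V hV
    let _ : Algebra k Γ(X, V) := ((constants f).app (op V)).hom.toAlgebra
    have : Algebra.FiniteType k Γ(X, V) := finiteType_constants hV
    let _ : Algebra k X.functionField :=
      ((algebraMap F.firstIntegralField X.functionField).comp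
        (algebraMap k F.firstIntegralField)).toAlgebra
    have : IsScalarTower k F.firstIntegralField X.functionField := .of_algebraMap_eq fun _ => rfl
    have : IsScalarTower k Γ(X, V) X.functionField := .of_algebraMap_eq fun c =>
      congrArg Subtype.val
        (IsScalarTower.algebraMap_apply k (F.firstIntegrals V) F.firstIntegralField c)
    obtain ⟨s, hs, halg⟩ := exists_finite_isAlgebraic_adjoin k Γ(X, V)
      (L := F.firstIntegralField) (K := X.functionField)
    exact ⟨s, hs, fun W _ hsW l => isAlgebraic_of_adjoin_le hsW (halg l)⟩
  obtain ⟨V, hηV, hV, hsV⟩ := F.exists_forall_mem_firstIntegrals (hs.image Subtype.val) (by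
    rintro _ ⟨x, -, rfl⟩
    exact x.2)
  have : Nonempty V := ⟨⟨_, hηV⟩⟩
  have halgV := halg V fun x hx => by
    obtain ⟨a, ha, hax⟩ := hsV x ⟨x, hx, rfl⟩
    exact ⟨⟨a, ha⟩, Subtype.ext hax⟩
  have := functionField_isFractionRing_of_isAffineOpen X V hV
  have := isIntegrallyClosed_of_isAffineOpen normal hV
  refine ⟨V, inferInstance, hV, ?_, ?_, halgV⟩
  · let _ : Algebra k Γ(X, V) := ((constants f).app (op V)).hom.toAlgebra
    have : IsScalarTower k (F.firstIntegrals V) Γ(X, V) := .of_algebraMap_eq fun _ => rfl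
    have : Algebra.FiniteType k Γ(X, V) := finiteType_constants hV
    exact .of_restrictScalars_finiteType k _ _
  · refine isFractionRing_of_isAlgebraic (B := Γ(X, V)) (K := X.functionField) halgV
      fun b l hbl => ?_
    exact ⟨⟨b, F.mem_firstIntegrals_of_isAlgebraic hV torsionFree halgV (hbl ▸ l.2)⟩, rfl⟩

open TensorProduct in
theorem isStable_genericPoint [CharZero k] [LocallyOfFiniteType f]
    (normal : ∀ x : X, IsIntegrallyClosed (X.presheaf.stalk x))
    (algebraicallyIntegrable : F.IsAlgebraicallyIntegrable) (torsionFree : F.IsTorsionFree) :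
    F.IsStable (genericPoint X) := by
  have := charZero_functionField f
  obtain ⟨V, _, hV, _, _, halg⟩ := F.exists_isFractionRing_firstIntegrals normal torsionFree
  have := functionField_isFractionRing_of_isAffineOpen X V hV
  have : CharZero F.firstIntegralField := inferInstance
  obtain ⟨a, b, hb, hab, H⟩ := exists_smooth_localization (A := F.firstIntegrals V) (B := Γ(X, V))
    (F.trdeg_firstIntegralField algebraicallyIntegrable)
    (fun x hx => ⟨⟨x, F.mem_firstIntegralField_of_isAlgebraic hx⟩, rfl⟩)
  let U := X.basicOpen b
  have hU : IsAffineOpen U := hV.basicOpen b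
  have hUV : U ≤ V := X.basicOpen_le b
  have hηV : genericPoint X ∈ V :=
    ((genericPoint_spec X).mem_open_set_iff V.isOpen).mpr (by simpa using ‹Nonempty V›)
  have hηU : genericPoint X ∈ U := by
    rw [Scheme.mem_basicOpen X b _ hηV]
    exact IsUnit.mk0 (G₀ := X.functionField) _
      ((map_ne_zero_iff _ (X.germToFunctionField_injective V)).mpr hb)
  have : Nonempty U := ⟨⟨_, hηU⟩⟩
  have : IsLocalization.Away b Γ(X, U) := hV.isLocalization_basicOpen b
  let _ : Algebra (F.firstIntegrals V) (F.firstIntegrals U) :=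
    (F.restrictFirstIntegrals hUV).toAlgebra
  have : IsScalarTower (F.firstIntegrals V) (F.firstIntegrals U) Γ(X, U) :=
    .of_algebraMap_eq fun _ => rfl
  have hUV' : IsScalarTower Γ(X, V) Γ(X, U) X.functionField := .of_algebraMap_eq fun x =>
    (X.presheaf.germ_res_apply (homOfLE hUV) _ hηU x).symm
  have : FaithfulSMul (F.firstIntegrals V) Γ(X, U) := by
    have h : Function.Injective (algebraMap (F.firstIntegrals V) X.functionField) :=
      (X.germToFunctionField_injective V).comp Subtype.val_injective
    rw [IsScalarTower.algebraMap_eq _ Γ(X, V), IsScalarTower.algebraMap_eq _ Γ(X, U),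
      RingHom.comp_assoc, RingHom.coe_comp] at h
    exact (faithfulSMul_iff_algebraMap_injective _ _).mpr h.of_comp
  have : IsScalarTower (F.firstIntegrals V) (F.firstIntegrals U) F.firstIntegralField :=
    F.isScalarTower_restrictFirstIntegrals hUV
  have hmem {x : Γ(X, U)} (hx : algebraMap Γ(X, U) X.functionField x ∈ F.firstIntegralField) :
      x ∈ F.firstIntegrals U :=
    F.mem_firstIntegrals_of_isAlgebraic hU torsionFree (F.isAlgebraic_of_le hUV halg) hx
  have : IsLocalization.Away a (F.firstIntegrals U) := by
    refine isLocalization_away_of_faithfullyFlat (B' := Γ(X, U)) ?_ (fun x => ?_) ?_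
    · obtain ⟨c, hc⟩ := hab
      obtain ⟨u, hu⟩ : IsUnit (algebraMap (F.firstIntegrals V) Γ(X, U) a) := by
        refine isUnit_of_dvd_unit ?_ (IsLocalization.Away.algebraMap_isUnit (S := Γ(X, U)) b)
        exact ⟨algebraMap Γ(X, V) Γ(X, U) c, (congrArg _ hc).trans (map_mul _ _ _)⟩
      have hinv : (u⁻¹ : Γ(X, U)ˣ).1 ∈ F.firstIntegrals U := hmem (by
        have hua : algebraMap Γ(X, U) X.functionField u ∈ F.firstIntegralField := by
          rw [hu]
          exact F.algebraMap_mem_firstIntegralField U (algebraMap _ (F.firstIntegrals U) a)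
        have e : algebraMap Γ(X, U) X.functionField (u⁻¹ : Γ(X, U)ˣ) =
            (algebraMap Γ(X, U) X.functionField u)⁻¹ :=
          eq_inv_of_mul_eq_one_left (by rw [← map_mul, Units.inv_mul, map_one])
        rw [e]
        exact F.firstIntegralField.inv_mem hua)
      refine IsUnit.of_mul_eq_one ⟨_, hinv⟩ (Subtype.ext ?_)
      change algebraMap (F.firstIntegrals V) Γ(X, U) a * (u⁻¹ : Γ(X, U)ˣ).1 = 1
      rw [← hu, Units.mul_inv]
    · obtain ⟨p, q, hq, h⟩ := IsFractionRing.div_surjective (A := F.firstIntegrals V)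
        (algebraMap (F.firstIntegrals U) F.firstIntegralField x)
      refine ⟨p, q, nonZeroDivisors.ne_zero hq,
        FaithfulSMul.algebraMap_injective (F.firstIntegrals U) F.firstIntegralField ?_⟩
      rw [map_mul, ← IsScalarTower.algebraMap_apply, ← IsScalarTower.algebraMap_apply, ← h]
      exact mul_div_cancel₀ _ ((map_ne_zero_iff _ (IsFractionRing.injective _ _)).mpr
        (nonZeroDivisors.ne_zero hq))
    · intro _ _
      obtain ⟨h₁, h₂⟩ := H (Localization.Away a) Γ(X, U)
      exact faithfullyFlat_of_isStandardSmoothOfRelativeDimension F.rank fun κ _ _ =>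
        (h₂ κ).toNontrivial
  obtain ⟨h₁, h₂⟩ := H (F.firstIntegrals U) Γ(X, U)
  have h₃ : SmoothOfRelativeDimension F.rank (F.toSpecFirstIntegrals U) :=
    smoothOfRelativeDimension_specMap F.rank
  exact ⟨U, hU, hηU, h₃.smooth, h₃, geometricallyConnected_specMap h₂⟩

end Distribution

end Foliated

theorem proposition4p28 {k : Type u} [Field k] [CharZero k] {X : Scheme.{u}} [IsIntegral X]
    (f : X ⟶ Spec (CommRingCat.of k)) [LocallyOfFiniteType f]
    (normal : ∀ x : X, IsIntegrallyClosed (X.presheaf.stalk x))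
    (F : Foliated.Distribution f) (involutive : F.IsInvolutive)
    (algebraicallyIntegrable : F.IsAlgebraicallyIntegrable) (torsionFree : F.IsTorsionFree)
    (finiteType : F.FirstIntegralsLocallyOfFiniteType) :
    F.IsStable (genericPoint X) := by
  exact F.isStable_genericPoint normal algebraicallyIntegrable torsionFree
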